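/- **Setting.** Let $P\subset\mathbb{R}^m$ be a convex polytope of dimension $d\ge 1$. "Face" means nonempty face, with $P$ itself counted as a face of $P$. A choice of apexes assigns to each face $F$ of $P$ a vertex $\mathbf v_F$ of $F$. A *pointed triangulation* of $P$ with apexes $\mathbf v$ is a finite simplicial complex $\mathcal C_P$ with underlying set $P$, together with a choice of apexes, such that, with $\mathcal C_F=\{S\in\mathcal C_P: S\subseteq F\}$ for each face $F$ of $P$, 1. $\mathbf v_F$ lies in every $(\dim F)$-dimensional simplex of $\mathcal C_F$; 2. if $F_1,F_2$ are faces with $\mathbf v_{F_1},\mathbf v_{F_2}\in F_1\cap F_2$, then $\mathbf v_{F_1}=\mathbf v_{F_2}$; 3. for each vertex $\mathbf w\ne\mathbf v_F$ of $F$, the edge $\mathrm{Conv}\{\mathbf v_F,\mathbf w\}$ belongs to $\mathcal C_F$. Given a choice of apexes, the polytope numbers $F(n)$ and interior polytope numbers $F(n)^\#$, $n\ge 0$, of the faces $F$ of $P$ are defined recursively. If $\dim F=0$, then $F(0)=F(0)^\#=0$ and $F(n)=F(n)^\#=1$ for $n\ge1$. If $\dim F>0$, then $F(0)=F(0)^\#=0$,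 $F(1)=1$, $F(1)^\#=0$, and for $n\ge2$ $$F(n)=F(n-1)+\sum_{\mathbf v_F\notin G}G(n)^\#,\qquad F(n)^\#=F(n)-\sum_{G\ne F}G(n)^\#,$$ where $G$ runs over the faces of $F$. Let $\alpha^d(r)=\binom{r+d-1}{d}$ for integers $r\ge1$ and $\alpha^d(r)=0$ for $r\le0$. The $h$-vector $(h_0,\dots,h_{d+1})$ of a $d$-dimensional simplicial complex is given by $$h_k=\sum_{i=0}^{k}(-1)^{k-i}\binom{d+1-i}{d+1-k}f_{i-1},$$ where $f_i$ is the number of $i$-dimensional simplices and $f_{-1}=1$. **Theorem.** The polytope $P$ has a pointed triangulation. For every pointed triangulation $\mathcal C_P$ of $P$, with $h$-vector $(h_0,\dots,h_{d+1})$, the interior polytope numbers of $P$ with respect to its apexes satisfy $$P(n)^\#=\sum_{j=0}^{d-1}h_j\,\alpha^d(n-d-1+j)\qquad\text{for all } n\ge0.$$ Here $\alpha^d$ is the simplex number sequence: for every $d$-simplex $S\subset\mathbb{R}^m$ and every choice of apexes for $S$, $S(n)=\alpha^d(n)$ for all $n\ge 0$. -/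

import Mathlib

/-- A polytope: the convex hull of a finite set of points. -/
def IsPolytope {E : Type*} [AddCommGroup E] [Module ℝ E] (P : Set E) : Prop :=
  ∃ V : Finset E, P = convexHull ℝ (V : Set E)

/-- The dimension of a nonempty set: the dimension of its affine hull. -/
noncomputable def polyDim {E : Type*} [AddCommGroup E] [Module ℝ E] (P : Set E) : ℕ :=
  Module.finrank ℝ (vectorSpan ℝ P)

/-- The nonempty faces of `P` (including `P` itself when `P` is nonempty): the sets of maximizers
over `P` of a linear functional. -/
def polyFaces {m : ℕ} (P : Set (EuclideanSpace ℝ (Fin m))) :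
    Set (Set (EuclideanSpace ℝ (Fin m))) :=
  {F | IsExposed ℝ P F ∧ F.Nonempty}

/-- A proper face has smaller dimension; this justifies the recursion defining polytope numbers. -/
theorem polyDim_lt {m : ℕ} {P F : Set (EuclideanSpace ℝ (Fin m))} (hF : F ∈ polyFaces P)
    (hne : F ≠ P) : polyDim F < polyDim P := by
  obtain ⟨hexp, hnon⟩ := hF
  obtain ⟨l, hl⟩ := hexp hnon
  have hsub : F ⊆ P := hexp.subset
  obtain ⟨x, hx⟩ := hnon
  obtain ⟨y, hyP, hyF⟩ : ∃ y ∈ P, y ∉ F := by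
    by_contra! h
    exact hne (Set.Subset.antisymm hsub h)
  have hle : vectorSpan ℝ F ≤ LinearMap.ker (l : EuclideanSpace ℝ (Fin m) →ₗ[ℝ] ℝ) := by
    unfold vectorSpan
    rw [Submodule.span_le]
    rintro z ⟨a, ha, b, hb, rfl⟩
    rw [hl] at ha hb
    have h1 := ha.2 b hb.1
    have h2 := hb.2 a ha.1
    simp only [vsub_eq_sub, SetLike.mem_coe, LinearMap.mem_ker, map_sub,
      ContinuousLinearMap.coe_coe]
    linarith
  apply Submodule.finrank_lt_finrank_of_lt
  refine lt_of_le_of_ne (vectorSpan_mono ℝ hsub) fun heq => ?_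
  have hmem : y -ᵥ x ∈ vectorSpan ℝ F := by
    rw [heq]
    exact vsub_mem_vectorSpan ℝ hyP (hsub hx)
  have h0 := hle hmem
  simp only [vsub_eq_sub, LinearMap.mem_ker, map_sub, ContinuousLinearMap.coe_coe] at h0
  apply hyF
  rw [hl] at hx ⊢
  refine ⟨hyP, fun z hz => ?_⟩
  have := hx.2 z hz
  linarith

/-- A choice of apexes for `P`: to every nonempty face `F` of `P` a vertex `v F` of `F`. -/
def IsApexChoice {m : ℕ} (P : Set (EuclideanSpace ℝ (Fin m)))
    (v : Set (EuclideanSpace ℝ (Fin m)) → EuclideanSpace ℝ (Fin m)) : Prop :=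
  ∀ F ∈ polyFaces P, v F ∈ F.extremePoints ℝ

mutual

/-- The polytope number `P(n)` with respect to the apexes `v`. -/
noncomputable def polytopeNumber {m : ℕ}
    (v : Set (EuclideanSpace ℝ (Fin m)) → EuclideanSpace ℝ (Fin m))
    (P : Set (EuclideanSpace ℝ (Fin m))) (n : ℕ) : ℤ :=
  match n with
  | 0 => 0
  | 1 => 1
  | n + 2 =>
    if polyDim P = 0 then 1
    else polytopeNumber v P (n + 1) +
      ∑ᶠ (F : Set (EuclideanSpace ℝ (Fin m))) (_ : (F ∈ polyFaces P ∧ F ≠ P) ∧ v P ∉ F),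
        interiorNumber v F (n + 2)
termination_by (polyDim P, n, 0)
decreasing_by
  · apply Prod.Lex.right
    apply Prod.Lex.left
    omega
  · rename_i h
    exact Prod.Lex.left _ _ (polyDim_lt h.1.1 h.1.2)

/-- The interior polytope number `P(n)^#` with respect to the apexes `v`. -/
noncomputable def interiorNumber {m : ℕ}
    (v : Set (EuclideanSpace ℝ (Fin m)) → EuclideanSpace ℝ (Fin m))
    (P : Set (EuclideanSpace ℝ (Fin m))) (n : ℕ) : ℤ :=
  match n with
  | 0 => 0
  | 1 => if polyDim P = 0 then 1 else 0
  | n + 2 =>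
    if polyDim P = 0 then 1
    else polytopeNumber v P (n + 2) -
      ∑ᶠ (F : Set (EuclideanSpace ℝ (Fin m))) (_ : F ∈ polyFaces P ∧ F ≠ P),
        interiorNumber v F (n + 2)
termination_by (polyDim P, n, 1)
decreasing_by
  · apply Prod.Lex.right
    apply Prod.Lex.right
    omega
  · rename_i h
    exact Prod.Lex.left _ _ (polyDim_lt h.1 h.2)

end

/-- `K` is a pointed triangulation of the polytope `P` with apexes `v`. The triangulation of a face
`F` consists of the simplices of `K` that lie in `F`. -/
structure IsPointedTriangulation {m : ℕ} (P : Set (EuclideanSpace ℝ (Fin m)))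
    (K : Geometry.SimplicialComplex ℝ (EuclideanSpace ℝ (Fin m)))
    (v : Set (EuclideanSpace ℝ (Fin m)) → EuclideanSpace ℝ (Fin m)) : Prop where
  finite : K.faces.Finite
  space_eq : K.space = P
  apex_vertex : IsApexChoice P v
  /-- The apex of a `k`-face lies in every `k`-simplex of the triangulation of that face. -/
  apex_mem : ∀ F ∈ polyFaces P, ∀ s ∈ K.faces, convexHull ℝ (s : Set _) ⊆ F →
    s.card = polyDim F + 1 → v F ∈ convexHull ℝ (s : Set (EuclideanSpace ℝ (Fin m)))
  apex_eq : ∀ F₁ ∈ polyFaces P, ∀ F₂ ∈ polyFaces P,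
    v F₁ ∈ F₁ ∩ F₂ → v F₂ ∈ F₁ ∩ F₂ → v F₁ = v F₂
  /-- The apex of a face is joined to all its other vertices by edges of the triangulation. -/
  edge_mem : ∀ F ∈ polyFaces P, ∀ w ∈ F.extremePoints ℝ, w ≠ v F →
    ∃ e ∈ K.faces, (e : Set (EuclideanSpace ℝ (Fin m))) = {v F, w}

/-- The number `f_{i-1}` of `(i-1)`-dimensional simplices, those with `i` vertices; `f_{-1} = 1`
counts the empty simplex. -/
noncomputable def simplexCount {m : ℕ}
    (K : Geometry.SimplicialComplex ℝ (EuclideanSpace ℝ (Fin m))) (i : ℕ) : ℕ :=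
  if i = 0 then 1 else {s ∈ K.faces | s.card = i}.ncard

/-- The component `h_k` of the `h`-vector `(h_0, …, h_{d+1})` of a `d`-dimensional complex. -/
noncomputable def hComponent {m : ℕ} (d : ℕ)
    (K : Geometry.SimplicialComplex ℝ (EuclideanSpace ℝ (Fin m))) (k : ℕ) : ℤ :=
  ∑ i ∈ Finset.range (k + 1),
    (-1) ^ (k - i) * ((d + 1 - i).choose (d + 1 - k) : ℤ) * (simplexCount K i : ℤ)

/-- The simplex numbers `α^d(r)`, equal to `0` for `r ≤ 0`. -/
def simplexNumber (d : ℕ) (r : ℤ) : ℤ :=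
  if r ≤ 0 then 0 else ((r.toNat + d - 1).choose d : ℤ)

/-!
The formulas come from counting the simplices of a triangulation `K` of the polytope `P`.

*Counting.* Call a family of simplices conical (`IsConical`) if its part in each face `F` consists
of the apex `v F`, of simplices lying in faces of `F` that avoid `v F`, and of the cones with apex
`v F` over these. The recursion defining the polytope numbers is then Pascal's rule, and
`IsConical.numbers` gives, for `n ≥ 0`,
`F(n + 2) = ∑ (n.choose (dim s))` over the simplices `s` of `F`, and `F(n + 2)^#` is the same sum
over the simplices interior to `F`. A pointed triangulation is conical: since all full-dimensional
simplices of a face `F` contain `v F` and these simplices cover `F`, every point of `F` lies in the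
star of `v F` (`IsPointedTriangulation.exists_star`), and the uniqueness of the open simplex
containing a given point does the rest (`isConical_of_star`). The faces of a simplex are conical for
every choice of apexes, so that its polytope numbers come from Vandermonde's identity
(`polytopeNumber_simplex`).

*The `h`-vector.* Choose a point `q` of `P` off the affine hulls of all simplices of dimension less
than `d`, and for a `d`-simplex `S` of `K` let `A S` be the set of vertices of `S` at which `q` has
negative barycentric coordinate. Moving from a point in the interior of a simplex `s` slightly
towards `q` one enters a unique `d`-simplex `S`, characterized by `A S ⊆ s ⊆ S`. Hence the intervals
`[A S, S]` partition `K` together with its empty simplex, and `h_k` is the number of `S` with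
`k = #(A S)` (`hComponent_eq_card`). Moving away from `q` instead stays in `P` exactly for the
interior simplices, so that the intervals `[S \ A S, S]` partition those (`sum_interior_faces_eq`).
By Vandermonde's identity the interval of `S` contributes `(n + #(A S)).choose d` to `P(n + 2)^#`,
which is the value of the simplex number sequence in question. No `S` has `#(A S) ≥ d`, because the
vertices of a pointed triangulation are not interior to `P`; this is why the sum stops at `d - 1`.

*Existence.* Let `v F` be the first vertex of `F` in an enumeration of the vertices of `P`. The sets
`{v F₁, …, v Fₖ}`, for chains of faces in which each face avoids the apex of the next, are the
simplices of the pulling triangulation (`pullingComplex`). They cover `P`, as is seen by shooting a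
ray from `v F` through a point of `F` until it leaves `F` (`exists_exit_point`), and their relative
interiors are disjoint because two faces avoiding a point cannot meet a ray from it in different
points (`eq_of_same_ray`).

For the face structure of polytopes one needs that the minimal face at a point, described by
prolongation of segments (`carrierFace`), is exposed (`carrierFace_mem_polyFaces`); it follows that
faces of faces are faces.
-/

/-! ### Open simplices -/

/-- The relative interior of the simplex with vertex set `s`: the combinations of the points of `s`
in which every point has positive weight. For `s = ∅` it is empty. -/
def openSimplex {E : Type*} [AddCommGroup E] [Module ℝ E] (s : Finset E) : Set E :=
  {x | ∃ w : E → ℝ, (∀ i ∈ s, 0 < w i) ∧ ∑ i ∈ s, w i = 1 ∧ ∑ i ∈ s, w i • i = x}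

section OpenSimplex

variable {E : Type*} [AddCommGroup E] [Module ℝ E]

theorem openSimplex_subset_convexHull (s : Finset E) :
    openSimplex s ⊆ convexHull ℝ (s : Set E) := by
  rintro x ⟨w, hw, h1, hx⟩
  exact Finset.mem_convexHull'.2 ⟨w, fun i hi => (hw i hi).le, h1, hx⟩

theorem nonempty_of_mem_openSimplex {s : Finset E} {x : E} (hx : x ∈ openSimplex s) :
    s.Nonempty := by
  obtain ⟨w, -, h1, -⟩ := hx
  rcases s.eq_empty_or_nonempty with rfl | h
  · simp at h1
  · exact h

theorem openSimplex_nonempty {s : Finset E} (hs : s.Nonempty) : (openSimplex s).Nonempty := by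
  have hc : (0 : ℝ) < s.card := by exact_mod_cast hs.card_pos
  refine ⟨_, fun _ => (s.card : ℝ)⁻¹, fun i _ => by positivity, ?_, rfl⟩
  simp [hc.ne']

theorem exists_openSimplex_of_mem_convexHull {s : Finset E} {x : E}
    (hx : x ∈ convexHull ℝ (s : Set E)) : ∃ t ⊆ s, x ∈ openSimplex t := by
  classical
  obtain ⟨w, hw, h1, h2⟩ := Finset.mem_convexHull'.1 hx
  have hz : ∀ i ∈ s, ¬ 0 < w i → w i = 0 := fun i hi h => le_antisymm (not_lt.1 h) (hw i hi)
  refine ⟨s.filter (0 < w ·), s.filter_subset _, w, fun i hi => (Finset.mem_filter.1 hi).2, ?_, ?_⟩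
  · rw [Finset.sum_filter, ← h1]
    refine Finset.sum_congr rfl fun i hi => ?_
    split_ifs with h
    · rfl
    · exact (hz i hi h).symm
  · rw [Finset.sum_filter, ← h2]
    refine Finset.sum_congr rfl fun i hi => ?_
    split_ifs with h
    · rfl
    · rw [hz i hi h, zero_smul]

@[simp]
theorem mem_openSimplex_singleton {x y : E} : x ∈ openSimplex ({y} : Finset E) ↔ x = y := by
  constructor
  · rintro ⟨w, -, h1, h2⟩
    simp only [Finset.sum_singleton] at h1 h2
    rw [← h2, h1, one_smul]
  · rintro rfl
    exact ⟨fun _ => 1, by simp, by simp, by simp⟩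

/-- A point of the open simplex on `s`, expressed in any way by weights on the affinely independent
set `s`, has positive weights. -/
theorem weight_pos_of_mem_openSimplex {s : Finset E} {x : E}
    (hs : AffineIndependent ℝ ((↑) : s → E)) (hx : x ∈ openSimplex s) {c : E → ℝ}
    (h1 : ∑ i ∈ s, c i = 1) (h2 : ∑ i ∈ s, c i • i = x) : ∀ i ∈ s, 0 < c i := by
  obtain ⟨w, hw, hw1, hw2⟩ := hx
  intro i hi
  rw [hs.eq_of_sum_eq_sum_subtype (h1.trans hw1.symm) (h2.trans hw2.symm) i hi]
  exact hw i hi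

/-- In a simplicial complex, a simplex meeting the open simplex on `s` has `s` as a face. -/
theorem subset_of_mem_openSimplex_of_mem_convexHull
    {K : Geometry.SimplicialComplex ℝ E} {s t : Finset E} (hs : s ∈ K.faces) (ht : t ∈ K.faces)
    {x : E} (hxs : x ∈ openSimplex s) (hxt : x ∈ convexHull ℝ (t : Set E)) : s ⊆ t := by
  classical
  have h := K.inter_subset_convexHull hs ht ⟨openSimplex_subset_convexHull s hxs, hxt⟩
  rw [← Finset.coe_inter] at h
  obtain ⟨w, -, h1, h2⟩ := Finset.mem_convexHull'.1 h
  have hpos := weight_pos_of_mem_openSimplex (c := fun i => if i ∈ t then w i else 0)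
    (K.indep hs) hxs
    (by rw [← Finset.sum_filter, Finset.filter_mem_eq_inter, h1])
    (by simp only [ite_smul, zero_smul]; rw [← Finset.sum_filter, Finset.filter_mem_eq_inter, h2])
  intro i hi
  by_contra hit
  have := hpos i hi
  simp [hit] at this

theorem eq_of_mem_openSimplex {K : Geometry.SimplicialComplex ℝ E} {s t : Finset E}
    (hs : s ∈ K.faces) (ht : t ∈ K.faces) {x : E} (hxs : x ∈ openSimplex s)
    (hxt : x ∈ openSimplex t) : s = t :=
  (subset_of_mem_openSimplex_of_mem_convexHull hs ht hxs
    (openSimplex_subset_convexHull t hxt)).antisymm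
  (subset_of_mem_openSimplex_of_mem_convexHull ht hs hxt (openSimplex_subset_convexHull s hxs))

theorem exists_openSimplex_of_mem_space {K : Geometry.SimplicialComplex ℝ E} {x : E}
    (hx : x ∈ K.space) : ∃ s ∈ K.faces, x ∈ openSimplex s := by
  obtain ⟨s, hs, hxs⟩ := Geometry.SimplicialComplex.mem_space_iff.1 hx
  obtain ⟨t, hts, hxt⟩ := exists_openSimplex_of_mem_convexHull hxs
  exact ⟨t, K.down_closed hs hts (nonempty_of_mem_openSimplex hxt), hxt⟩

/-- The open segment from `v` to a point of the open simplex on `s` lies in the open simplex on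
`s ∪ {v}`, also when `v ∈ s`. -/
theorem mem_openSimplex_insert [DecidableEq E] {s : Finset E} {v y : E} (hy : y ∈ openSimplex s)
    {a : ℝ} (ha0 : 0 < a) (ha1 : a < 1) : a • v + (1 - a) • y ∈ openSimplex (insert v s) := by
  obtain ⟨w, hw, h1, rfl⟩ := hy
  have hsub : s ⊆ insert v s := Finset.subset_insert v s
  have hsum : ∀ f : E → ℝ, ∑ i ∈ insert v s, (if i ∈ s then f i else 0) = ∑ i ∈ s, f i := by
    intro f
    rw [← Finset.sum_filter, Finset.filter_mem_eq_inter, Finset.inter_eq_right.2 hsub]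
  have hsum' : ∀ f : E → E, ∑ i ∈ insert v s, (if i ∈ s then f i else 0) = ∑ i ∈ s, f i := by
    intro f
    rw [← Finset.sum_filter, Finset.filter_mem_eq_inter, Finset.inter_eq_right.2 hsub]
  refine ⟨fun i => (if i = v then a else 0) + (1 - a) * (if i ∈ s then w i else 0), ?_, ?_, ?_⟩
  · intro i hi
    have h1a : 0 < 1 - a := by linarith
    beta_reduce
    rcases Finset.mem_insert.1 hi with rfl | his
    · rw [if_pos rfl]
      split_ifs with h
      · have := mul_pos h1a (hw _ h); linarith
      · linarith
    · rw [if_pos his]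
      have := mul_pos h1a (hw _ his)
      split_ifs <;> linarith
  · rw [Finset.sum_add_distrib, ← Finset.mul_sum, hsum, h1]
    simp
  · simp only [add_smul, Finset.sum_add_distrib, mul_smul, ← Finset.smul_sum, ite_smul, zero_smul]
    rw [hsum' (fun i => w i • i)]
    simp

/-- A point of the open simplex on `s ∪ {v}`, with `v ∉ s ≠ ∅`, lies on an open segment from `v` to
the open simplex on `s`. -/
theorem exists_of_mem_openSimplex_insert [DecidableEq E] {s : Finset E} {v x : E} (hv : v ∉ s)
    (hs : s.Nonempty) (hx : x ∈ openSimplex (insert v s)) :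
    ∃ a : ℝ, 0 < a ∧ a < 1 ∧ ∃ y ∈ openSimplex s, x = a • v + (1 - a) • y := by
  obtain ⟨w, hw, h1, rfl⟩ := hx
  rw [Finset.sum_insert hv] at h1
  have hpos : 0 < ∑ i ∈ s, w i :=
    Finset.sum_pos (fun i hi => hw i (Finset.mem_insert_of_mem hi)) hs
  have ha : 0 < 1 - w v := by linarith
  refine ⟨w v, hw v (Finset.mem_insert_self _ _), by linarith,
    ∑ i ∈ s, ((1 - w v)⁻¹ * w i) • i, ⟨fun i => (1 - w v)⁻¹ * w i, ?_, ?_, rfl⟩, ?_⟩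
  · intro i hi
    exact mul_pos (inv_pos.2 ha) (hw i (Finset.mem_insert_of_mem hi))
  · rw [← Finset.mul_sum, inv_mul_eq_one₀ ha.ne']
    linarith
  · simp only [mul_smul]
    rw [Finset.sum_insert hv, ← Finset.smul_sum, smul_inv_smul₀ ha.ne']

end OpenSimplex

/-! ### Faces of polytopes -/

section Faces

variable {m : ℕ}

local notation "𝔼" => EuclideanSpace ℝ (Fin m)

theorem IsPolytope.convex {P : Set 𝔼} (hP : IsPolytope P) : Convex ℝ P := by
  obtain ⟨V, rfl⟩ := hP
  exact convex_convexHull ℝ _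

theorem IsPolytope.isCompact {P : Set 𝔼} (hP : IsPolytope P) : IsCompact P := by
  obtain ⟨V, rfl⟩ := hP
  exact V.finite_toSet.isCompact_convexHull ℝ

theorem IsPolytope.finite_extremePoints {P : Set 𝔼} (hP : IsPolytope P) :
    (P.extremePoints ℝ).Finite := by
  obtain ⟨V, rfl⟩ := hP
  exact V.finite_toSet.subset extremePoints_convexHull_subset

theorem polyFaces_subset {P F : Set 𝔼} (hF : F ∈ polyFaces P) : F ⊆ P := hF.1.subset

theorem self_mem_polyFaces {P : Set 𝔼} (hP : P.Nonempty) : P ∈ polyFaces P :=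
  ⟨IsExposed.refl P, hP⟩

/-- A point of a face that is a positive combination of points of `P` has all of them in the
face. -/
theorem subset_face_of_mem_openSimplex {P F : Set 𝔼} (hF : F ∈ polyFaces P) {s : Finset 𝔼}
    (hs : (s : Set 𝔼) ⊆ P) {x : 𝔼} (hxs : x ∈ openSimplex s) (hxF : x ∈ F) : (s : Set 𝔼) ⊆ F := by
  obtain ⟨l, hl⟩ := hF.1 hF.2
  obtain ⟨w, hw, h1, rfl⟩ := hxs
  rw [hl] at hxF ⊢
  obtain ⟨-, hmax⟩ := hxF
  set M := l (∑ i ∈ s, w i • i) with hM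
  have hsum : ∑ i ∈ s, w i * (M - l i) = 0 := by
    simp only [mul_sub, Finset.sum_sub_distrib, ← Finset.sum_mul, h1]
    rw [hM, map_sum]
    simp
  have hz := (Finset.sum_eq_zero_iff_of_nonneg fun i hi =>
    mul_nonneg (hw i hi).le (sub_nonneg.2 (hmax i (hs hi)))).1 hsum
  intro i hi
  refine ⟨hs hi, fun y hy => (hmax y hy).trans ?_⟩
  have := (mul_eq_zero.1 (hz i hi)).resolve_left (hw i hi).ne'
  linarith

/-- The face of `P` that has `x` in its relative interior: the points `y` of `P` such that the
segment from `y` to `x` can be prolonged beyond `x` within `P`. -/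
def carrierFace (P : Set 𝔼) (x : 𝔼) : Set 𝔼 :=
  {y ∈ P | ∃ ε : ℝ, 0 < ε ∧ x + ε • (x - y) ∈ P}

theorem carrierFace_subset (P : Set 𝔼) (x : 𝔼) : carrierFace P x ⊆ P := fun _ hy => hy.1

theorem mem_carrierFace_self {P : Set 𝔼} {x : 𝔼} (hx : x ∈ P) : x ∈ carrierFace P x :=
  ⟨hx, 1, one_pos, by simpa using hx⟩

theorem carrierFace_subset_face {P F : Set 𝔼} (hF : F ∈ polyFaces P) {x : 𝔼} (hx : x ∈ F) :
    carrierFace P x ⊆ F := by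
  rintro y ⟨hy, ε, hε, hz⟩
  have h1 : 1 + ε ≠ 0 := by positivity
  refine hF.1.isExtreme.left_mem_of_mem_openSegment hy hz hx
    ⟨ε / (1 + ε), 1 / (1 + ε), by positivity, by positivity, by field_simp; ring, ?_⟩
  match_scalars <;> field_simp
  ring

/-- `g` is a feasible direction of `P` at `x`: one can move from `x` a little along `g`
within `P`. -/
def IsFeasible (P : Set 𝔼) (x g : 𝔼) : Prop := ∃ ε : ℝ, 0 < ε ∧ x + ε • g ∈ P

theorem IsFeasible.add {P : Set 𝔼} (hP : Convex ℝ P) {x g h : 𝔼} (hg : IsFeasible P x g)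
    (hh : IsFeasible P x h) : IsFeasible P x (g + h) := by
  obtain ⟨a, ha, hga⟩ := hg
  obtain ⟨b, hb, hhb⟩ := hh
  refine ⟨a * b / (a + b), by positivity, ?_⟩
  convert! hP hga hhb (a := b / (a + b)) (b := a / (a + b)) (by positivity) (by positivity)
    (by field_simp; ring) using 1
  match_scalars <;> field_simp
  ring

theorem IsFeasible.smul {P : Set 𝔼} {x g : 𝔼} (hg : IsFeasible P x g) {c : ℝ} (hc : 0 < c) :
    IsFeasible P x (c • g) := by
  obtain ⟨a, ha, hga⟩ := hg
  refine ⟨a / c, by positivity, ?_⟩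
  rwa [smul_smul, div_mul_cancel₀ _ hc.ne']

theorem isFeasible_zero {P : Set 𝔼} {x : 𝔼} (hx : x ∈ P) : IsFeasible P x 0 :=
  ⟨1, one_pos, by simpa using hx⟩

theorem isFeasible_sub {P : Set 𝔼} {x y : 𝔼} (hy : y ∈ P) : IsFeasible P x (y - x) :=
  ⟨1, one_pos, by simpa using hy⟩

theorem convex_carrierFace {P : Set 𝔼} (hP : Convex ℝ P) (x : 𝔼) :
    Convex ℝ (carrierFace P x) := by
  refine convex_iff_forall_pos.2 fun y hy z hz a b ha hb hab =>
    ⟨hP hy.1 hz.1 ha.le hb.le hab, ?_⟩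
  have h : x - (a • y + b • z) = a • (x - y) + b • (x - z) := by
    rw [smul_sub, smul_sub, sub_add_sub_comm, ← add_smul, hab, one_smul]
  change IsFeasible P x _
  rw [h]
  exact (IsFeasible.smul hy.2 ha).add hP (IsFeasible.smul hz.2 hb)

theorem isExtreme_carrierFace {P : Set 𝔼} (hP : Convex ℝ P) (x : 𝔼) :
    IsExtreme ℝ P (carrierFace P x) := by
  refine ⟨carrierFace_subset P x, fun p hp r hr y hy hyo => ⟨hp, ?_⟩⟩
  obtain ⟨a, b, ha, hb, hab, rfl⟩ := hyo
  have h : x - p = a⁻¹ • ((x - (a • p + b • r)) + b • (r - x)) := by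
    obtain rfl : b = 1 - a := by linarith
    match_scalars <;> field_simp <;> ring
  change IsFeasible P x _
  rw [h]
  exact ((IsFeasible.add hP hy.2 ((isFeasible_sub hr).smul hb))).smul (inv_pos.2 ha)

/-- The minimal face of a polytope at one of its points is exposed. The vertices of `P` outside
that face are strictly separated from the affine space of directions spanned by those inside. -/
theorem carrierFace_mem_polyFaces {P : Set 𝔼} (hP : IsPolytope P) {x : 𝔼} (hx : x ∈ P) :
    carrierFace P x ∈ polyFaces P := by
  classical
  refine ⟨fun _ => ?_, x, mem_carrierFace_self hx⟩
  have hconv := hP.convex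
  obtain ⟨V, hV⟩ := hP
  have hVP : (V : Set 𝔼) ⊆ P := hV ▸ subset_convexHull ℝ _
  set A : Set 𝔼 := {a | a ∈ V ∧ a ∈ carrierFace P x} with hA
  set B : Set 𝔼 := {b | b ∈ V ∧ b ∉ carrierFace P x} with hB
  have hBfin : B.Finite := V.finite_toSet.subset fun b hb => hb.1
  have hBout : convexHull ℝ B ⊆ P \ carrierFace P x :=
    convexHull_min (fun b hb => ⟨hVP hb.1, hb.2⟩)
      ((isExtreme_carrierFace hconv x).convex_sdiff hconv)
  set L : Submodule ℝ 𝔼 := Submodule.span ℝ ((fun a => a - x) '' A) with hL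
  have hfeas : ∀ g ∈ L, IsFeasible P x g ∧ IsFeasible P x (-g) := by
    intro g hg
    induction hg using Submodule.span_induction with
    | mem g hg =>
      obtain ⟨a, ha, rfl⟩ := hg
      refine ⟨isFeasible_sub ha.2.1, ?_⟩
      simpa using! ha.2.2
    | zero => simpa using isFeasible_zero hx
    | add g h _ _ hg hh =>
      rw [neg_add]
      exact ⟨hg.1.add hconv hh.1, hg.2.add hconv hh.2⟩
    | smul c g _ hg =>
      rcases lt_trichotomy c 0 with hc | rfl | hc
      · have := hg.1.smul (neg_pos.2 hc)
        have := hg.2.smul (neg_pos.2 hc)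
        rw [neg_smul] at *
        rw [smul_neg, neg_neg] at this
        exact ⟨this, by assumption⟩
      · simpa using isFeasible_zero hx
      · rw [← smul_neg]
        exact ⟨hg.1.smul hc, hg.2.smul hc⟩
  have hclosed : IsClosed {z : 𝔼 | z - x ∈ L} :=
    (Submodule.closed_of_finiteDimensional L).preimage (continuous_id.sub continuous_const)
  have hconvL : Convex ℝ {z : 𝔼 | z - x ∈ L} := by
    intro y hy z hz a b _ _ hab
    have h : a • y + b • z - x = a • (y - x) + b • (z - x) := by
      obtain rfl : b = 1 - a := by linarith
      module
    change _ ∈ L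
    rw [h]
    exact L.add_mem (L.smul_mem _ hy) (L.smul_mem _ hz)
  have hdisj : Disjoint (convexHull ℝ B) {z : 𝔼 | z - x ∈ L} := by
    rw [Set.disjoint_left]
    intro z hz hzL
    refine (hBout hz).2 ⟨(hBout hz).1, ?_⟩
    have := (hfeas _ hzL).2
    rwa [neg_sub] at this
  obtain ⟨l, u, v, hlB, huv, hlL⟩ := geometric_hahn_banach_compact_closed (convex_convexHull ℝ B)
    (hBfin.isCompact_convexHull ℝ) hconvL hclosed hdisj
  -- A linear functional bounded below on the affine space `x + L` is constant on it.
  have hlzero : ∀ g ∈ L, l g = 0 := by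
    intro g hg
    by_contra hne
    have := hlL (x + ((v - l x) / l g) • g) (by simpa using L.smul_mem _ hg)
    rw [map_add, map_smul, smul_eq_mul, div_mul_cancel₀ _ hne] at this
    linarith
  have hlx : v < l x := hlL x (by simp)
  have hlA : ∀ a ∈ A, l a = l x := by
    intro a ha
    have := hlzero (a - x) (Submodule.subset_span ⟨a, ha, rfl⟩)
    rw [map_sub] at this
    linarith
  have hlV : ∀ a ∈ V, l a ≤ l x := by
    intro a ha
    by_cases h : a ∈ carrierFace P x
    · exact (hlA a ⟨ha, h⟩).le
    · linarith [hlB a (subset_convexHull ℝ _ ⟨ha, h⟩)]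
  have hlP : ∀ y ∈ P, l y ≤ l x := by
    have : P ⊆ {y | l y ≤ l x} := by
      rw [hV]
      exact convexHull_min hlV (convex_halfSpace_le l.toLinearMap.isLinear _)
    exact this
  refine ⟨l, Set.Subset.antisymm ?_ ?_⟩
  · rintro y ⟨hy, ε, hε, hz⟩
    refine ⟨hy, fun z hzP => (hlP z hzP).trans ?_⟩
    have := hlP _ hz
    rw [map_add, map_smul, map_sub, smul_eq_mul] at this
    nlinarith
  · rintro y ⟨hy, hmax⟩
    have hyx : l y = l x := le_antisymm (hlP y hy) (hmax x hx)
    have hyF : y ∈ l.toExposed P := ⟨hy, hmax⟩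
    rw [hV] at hy
    obtain ⟨t, htV, hyt⟩ := exists_openSimplex_of_mem_convexHull hy
    have ht : (t : Set 𝔼) ⊆ l.toExposed P :=
      subset_face_of_mem_openSimplex ⟨ContinuousLinearMap.toExposed.isExposed, y, hyF⟩
        ((Finset.coe_subset.2 htV).trans hVP) hyt hyF
    have htc : (t : Set 𝔼) ⊆ carrierFace P x := by
      intro a ha
      by_contra hac
      have h1 := hlB a (subset_convexHull ℝ _ ⟨htV ha, hac⟩)
      have h2 := (ht ha).2 x hx
      linarith
    exact convexHull_min htc (convex_carrierFace hconv x) (openSimplex_subset_convexHull t hyt)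

theorem isPolytope_of_mem_polyFaces {P F : Set 𝔼} (hP : IsPolytope P) (hF : F ∈ polyFaces P) :
    IsPolytope F := by
  classical
  have hconv := hF.1.convex hP.convex
  obtain ⟨V, rfl⟩ := hP
  refine ⟨V.filter (· ∈ F), Set.Subset.antisymm (fun x hx => ?_)
    (convexHull_min (fun a ha => (Finset.mem_filter.1 ha).2) hconv)⟩
  obtain ⟨t, htV, hxt⟩ := exists_openSimplex_of_mem_convexHull (polyFaces_subset hF hx)
  have ht := subset_face_of_mem_openSimplex hF
    ((Finset.coe_subset.2 htV).trans (subset_convexHull ℝ _)) hxt hx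
  refine convexHull_mono (fun a ha => ?_) (openSimplex_subset_convexHull t hxt)
  exact Finset.mem_filter.2 ⟨htV ha, ht ha⟩

theorem convex_of_mem_polyFaces {P F : Set 𝔼} (hP : IsPolytope P) (hF : F ∈ polyFaces P) :
    Convex ℝ F := (isPolytope_of_mem_polyFaces hP hF).convex

/-- A nonempty polytope is the minimal face of itself at one of its points. -/
theorem exists_carrierFace_eq_self {P : Set 𝔼} (hP : IsPolytope P) (hne : P.Nonempty) :
    ∃ x ∈ P, carrierFace P x = P := by
  obtain ⟨V, rfl⟩ := hP
  obtain ⟨x, hx⟩ := openSimplex_nonempty (s := V) (by simpa using hne)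
  have hxP := openSimplex_subset_convexHull V hx
  have hF := carrierFace_mem_polyFaces ⟨V, rfl⟩ hxP
  refine ⟨x, hxP, (carrierFace_subset _ _).antisymm (convexHull_min ?_ ?_)⟩
  · exact subset_face_of_mem_openSimplex hF (subset_convexHull ℝ _) hx (mem_carrierFace_self hxP)
  · exact convex_carrierFace (convex_convexHull ℝ _) x

/-- The minimal face at a point of a face `F` of `P` is the same in `F` as in `P`. -/
theorem carrierFace_eq_of_mem_face {P F : Set 𝔼} (hF : F ∈ polyFaces P) {x : 𝔼}
    (hx : x ∈ F) : carrierFace F x = carrierFace P x := by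
  ext y
  constructor
  · rintro ⟨hy, ε, hε, h⟩
    exact ⟨polyFaces_subset hF hy, ε, hε, polyFaces_subset hF h⟩
  · intro hy
    refine ⟨carrierFace_subset_face hF hx hy, ?_⟩
    obtain ⟨hy, ε, hε, h⟩ := hy
    refine ⟨ε, hε, hF.1.isExtreme.right_mem_of_mem_openSegment hy h hx ?_⟩
    have h1 : 1 + ε ≠ 0 := by positivity
    refine ⟨ε / (1 + ε), 1 / (1 + ε), by positivity, by positivity, by field_simp; ring, ?_⟩
    match_scalars <;> field_simp
    ring

theorem exists_carrierFace_eq {P F : Set 𝔼} (hP : IsPolytope P) (hF : F ∈ polyFaces P) :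
    ∃ x ∈ F, carrierFace P x = F := by
  obtain ⟨x, hx, h⟩ := exists_carrierFace_eq_self (isPolytope_of_mem_polyFaces hP hF) hF.2
  exact ⟨x, hx, (carrierFace_eq_of_mem_face hF hx).symm.trans h⟩

theorem polyFaces_trans {P F G : Set 𝔼} (hP : IsPolytope P) (hF : F ∈ polyFaces P)
    (hG : G ∈ polyFaces F) : G ∈ polyFaces P := by
  obtain ⟨x, hx, rfl⟩ := exists_carrierFace_eq (isPolytope_of_mem_polyFaces hP hF) hG
  have hxF := polyFaces_subset hG hx
  rw [carrierFace_eq_of_mem_face hF hxF]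
  exact carrierFace_mem_polyFaces hP (polyFaces_subset hF hxF)

theorem mem_polyFaces_of_subset {P F G : Set 𝔼} (hF : F ∈ polyFaces P) (hG : G ∈ polyFaces P)
    (h : G ⊆ F) : G ∈ polyFaces F :=
  ⟨hG.1.mono (polyFaces_subset hF) h, hG.2⟩

theorem finite_polyFaces {P : Set 𝔼} (hP : IsPolytope P) : (polyFaces P).Finite := by
  classical
  obtain ⟨V, hV⟩ := id hP
  refine (V.powerset.finite_toSet.image fun s : Finset 𝔼 => convexHull ℝ (s : Set 𝔼)).subset ?_
  intro F hF
  have hVP : (V : Set 𝔼) ⊆ P := hV ▸ subset_convexHull ℝ _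
  refine ⟨V.filter (· ∈ F), Finset.mem_coe.2 (Finset.mem_powerset.2 (V.filter_subset _)),
    Set.Subset.antisymm
    (convexHull_min (fun a ha => (Finset.mem_filter.1 ha).2) (convex_of_mem_polyFaces hP hF)) ?_⟩
  intro x hx
  have hxP := polyFaces_subset hF hx
  rw [hV] at hxP
  obtain ⟨t, htV, hxt⟩ := exists_openSimplex_of_mem_convexHull hxP
  have ht := subset_face_of_mem_openSimplex hF ((Finset.coe_subset.2 htV).trans hVP) hxt hx
  refine convexHull_mono (fun a ha => ?_) (openSimplex_subset_convexHull t hxt)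
  exact Finset.mem_filter.2 ⟨htV ha, ht ha⟩

theorem carrierFace_of_mem_extremePoints {P : Set 𝔼} {w : 𝔼} (hw : w ∈ P.extremePoints ℝ) :
    carrierFace P w = {w} := by
  refine Set.Subset.antisymm ?_ (Set.singleton_subset_iff.2 (mem_carrierFace_self hw.1))
  rintro y ⟨hy, ε, hε, h⟩
  have h1 : 1 + ε ≠ 0 := by positivity
  refine hw.2 hy h ⟨ε / (1 + ε), 1 / (1 + ε), by positivity, by positivity, by field_simp; ring, ?_⟩
  match_scalars <;> field_simp
  ring

theorem face_eq_of_polyDim_le {P F : Set 𝔼} (hF : F ∈ polyFaces P) (h : polyDim P ≤ polyDim F) :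
    F = P := by
  by_contra hne
  exact absurd (polyDim_lt hF hne) (not_lt.2 h)

end Faces

/-! ### Polytope numbers count simplices -/

section Counting

variable {m : ℕ}

local notation "𝔼" => EuclideanSpace ℝ (Fin m)

/-- `F` is the smallest of its faces containing `s`; geometrically, the simplex `s` lies in `F`
and its relative interior lies in the relative interior of `F`. -/
def IsCarrier (F : Set 𝔼) (s : Finset 𝔼) : Prop :=
  (s : Set 𝔼) ⊆ F ∧ ∀ G ∈ polyFaces F, (s : Set 𝔼) ⊆ G → G = F

theorem isCarrier_carrierFace {P : Set 𝔼} (hP : IsPolytope P) {s : Finset 𝔼}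
    (hs : (s : Set 𝔼) ⊆ P) {x : 𝔼} (hx : x ∈ openSimplex s) :
    IsCarrier (carrierFace P x) s := by
  have hxP := convexHull_min hs hP.convex (openSimplex_subset_convexHull s hx)
  have hF := carrierFace_mem_polyFaces hP hxP
  refine ⟨subset_face_of_mem_openSimplex hF hs hx (mem_carrierFace_self hxP), fun G hG hsG => ?_⟩
  have hGP := polyFaces_trans hP hF hG
  refine (polyFaces_subset hG).antisymm (carrierFace_subset_face hGP ?_)
  exact convexHull_min hsG (convex_of_mem_polyFaces hP hGP) (openSimplex_subset_convexHull s hx)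

theorem exists_isCarrier {P : Set 𝔼} (hP : IsPolytope P) {s : Finset 𝔼} (hs : s.Nonempty)
    (hsP : (s : Set 𝔼) ⊆ P) : ∃ F ∈ polyFaces P, IsCarrier F s := by
  obtain ⟨x, hx⟩ := openSimplex_nonempty hs
  exact ⟨_, carrierFace_mem_polyFaces hP
    (convexHull_min hsP hP.convex (openSimplex_subset_convexHull s hx)),
    isCarrier_carrierFace hP hsP hx⟩

/-- The carrier of `s` is contained in every face that contains `s`. -/
theorem IsCarrier.subset_of_subset {P F G : Set 𝔼} {s : Finset 𝔼}
    (hs : s.Nonempty) (hF : F ∈ polyFaces P) (hG : G ∈ polyFaces P) (hFs : IsCarrier F s)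
    (hGs : (s : Set 𝔼) ⊆ G) : F ⊆ G := by
  have hne : (F ∩ G).Nonempty := by
    obtain ⟨x, hx⟩ := hs
    exact ⟨x, hFs.1 hx, hGs hx⟩
  have hFG : F ∩ G ∈ polyFaces P := ⟨hF.1.inter hG.1, hne⟩
  have := hFs.2 _ (mem_polyFaces_of_subset hF hFG Set.inter_subset_left)
    (Set.subset_inter hFs.1 hGs)
  rw [← this]
  exact Set.inter_subset_right

theorem IsCarrier.unique {P F G : Set 𝔼} {s : Finset 𝔼}
    (hs : s.Nonempty) (hF : F ∈ polyFaces P) (hG : G ∈ polyFaces P) (hFs : IsCarrier F s)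
    (hGs : IsCarrier G s) : F = G :=
  (hFs.subset_of_subset hs hF hG hGs.1).antisymm (hGs.subset_of_subset hs hG hF hFs.1)

/-- A finite family of finite subsets of the polytope `P` which, within every face `F`, is the cone
with apex `v F` over its part in the faces of `F` that avoid `v F`. -/
structure IsConical (P : Set 𝔼) (v : Set 𝔼 → 𝔼) (K : Finset (Finset 𝔼)) : Prop where
  nonempty : ∀ s ∈ K, s.Nonempty
  subset : ∀ s ∈ K, (s : Set 𝔼) ⊆ P
  apex_mem : ∀ F ∈ polyFaces P, v F ∈ F
  singleton_mem : ∀ F ∈ polyFaces P, {v F} ∈ K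
  insert_mem : ∀ F ∈ polyFaces P, ∀ G ∈ polyFaces F, v F ∉ G → ∀ t ∈ K, (t : Set 𝔼) ⊆ G →
    insert (v F) t ∈ K
  erase_mem : ∀ F ∈ polyFaces P, ∀ s ∈ K, (s : Set 𝔼) ⊆ F → s ≠ {v F} →
    s.erase (v F) ∈ K ∧ ∃ G ∈ polyFaces F, v F ∉ G ∧ (s.erase (v F) : Set 𝔼) ⊆ G

open scoped Classical in
/-- Each simplex of `K` in a face of a family closed under passing to smaller faces is counted once,
at its carrier. -/
theorem finsum_carrier {P F : Set 𝔼} (hP : IsPolytope P) {K : Finset (Finset 𝔼)}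
    (hK : ∀ s ∈ K, s.Nonempty) (hF : F ∈ polyFaces P) (p : Set 𝔼 → Prop)
    (hp : ∀ G, p G → G ∈ polyFaces F) (hmono : ∀ G H, p G → H ∈ polyFaces F → H ⊆ G → p H)
    (f : Finset 𝔼 → ℤ) :
    ∑ᶠ (G : Set 𝔼) (_ : p G), ∑ s ∈ K.filter (fun s : Finset 𝔼 => IsCarrier G s), f s =
      ∑ s ∈ K.filter (fun s : Finset 𝔼 => ∃ G, p G ∧ (s : Set 𝔼) ⊆ G), f s := by
  have hFpol := isPolytope_of_mem_polyFaces hP hF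
  have hfin : {G | p G}.Finite := (finite_polyFaces hFpol).subset hp
  have h1 := finsum_mem_eq_finite_toFinset_sum
    (fun G => ∑ s ∈ K.filter (fun s : Finset 𝔼 => IsCarrier G s), f s) hfin
  simp only [Set.mem_ofPred_eq] at h1
  rw [h1]
  simp_rw [Finset.sum_filter]
  rw [Finset.sum_comm]
  refine Finset.sum_congr rfl fun s hs => ?_
  split_ifs with h
  · obtain ⟨G, hG, hsG⟩ := h
    obtain ⟨H, hH, hHs⟩ := exists_isCarrier (isPolytope_of_mem_polyFaces hFpol (hp G hG))
      (hK s hs) hsG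
    have hHF := polyFaces_trans hFpol (hp G hG) hH
    have hpH := hmono G H hG hHF (polyFaces_subset hH)
    rw [Finset.sum_eq_single_of_mem H (hfin.mem_toFinset.2 hpH), if_pos hHs]
    intro H' hH' hne
    refine if_neg fun hH's => hne ?_
    exact hH's.unique (hK s hs) (hp _ (hfin.mem_toFinset.1 hH')) hHF hHs
  · refine Finset.sum_eq_zero fun G hG => if_neg fun hGs => h ⟨G, hfin.mem_toFinset.1 hG, hGs.1⟩

open scoped Classical in
/-- Summation over a cone: its members are the apex `{v F}`, the members `t` of the base, and the
cones `t ∪ {v F}` over them. -/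
theorem IsConical.sum_face {P F : Set 𝔼} {v : Set 𝔼 → 𝔼}
    {K : Finset (Finset 𝔼)} (hK : IsConical P v K) (hF : F ∈ polyFaces P) (f : Finset 𝔼 → ℤ) :
    ∑ s ∈ K.filter (fun s : Finset 𝔼 => (s : Set 𝔼) ⊆ F), f s = f {v F} +
      ∑ t ∈ K.filter (fun t : Finset 𝔼 => ∃ G, (G ∈ polyFaces F ∧ v F ∉ G) ∧ (t : Set 𝔼) ⊆ G),
        (f t + f (insert (v F) t)) := by
  set B := K.filter fun t : Finset 𝔼 => ∃ G, (G ∈ polyFaces F ∧ v F ∉ G) ∧ (t : Set 𝔼) ⊆ G with hB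
  have hBv : ∀ t ∈ B, v F ∉ t := by
    intro t ht h
    obtain ⟨-, G, ⟨-, hv⟩, htG⟩ := Finset.mem_filter.1 ht
    exact hv (htG h)
  have h0 : (K.filter fun s : Finset 𝔼 => (s : Set 𝔼) ⊆ F).filter (fun s => v F ∉ s) = B := by
    ext s
    simp only [Finset.mem_filter, hB]
    constructor
    · rintro ⟨⟨hs, hsF⟩, hv⟩
      have hne : s ≠ {v F} := by rintro rfl; exact hv (Finset.mem_singleton_self _)
      obtain ⟨-, G, hG, hvG, hsG⟩ := hK.erase_mem F hF s hs hsF hne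
      rw [Finset.erase_eq_of_notMem hv] at hsG
      exact ⟨hs, G, ⟨hG, hvG⟩, hsG⟩
    · rintro ⟨hs, G, ⟨hG, hvG⟩, hsG⟩
      exact ⟨⟨hs, hsG.trans (polyFaces_subset hG)⟩, fun h => hvG (hsG h)⟩
  have h1 : (K.filter fun s : Finset 𝔼 => (s : Set 𝔼) ⊆ F).filter (fun s => v F ∈ s) =
      insert {v F} (B.image (insert (v F))) := by
    ext s
    simp only [Finset.mem_filter, Finset.mem_insert, Finset.mem_image]
    constructor
    · rintro ⟨⟨hs, hsF⟩, hv⟩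
      by_cases hne : s = {v F}
      · exact Or.inl hne
      obtain ⟨he, G, hG, hvG, hsG⟩ := hK.erase_mem F hF s hs hsF hne
      exact Or.inr ⟨s.erase (v F), Finset.mem_filter.2 ⟨he, G, ⟨hG, hvG⟩, by simpa using hsG⟩,
        Finset.insert_erase hv⟩
    · rintro (rfl | ⟨t, ht, rfl⟩)
      · exact ⟨⟨hK.singleton_mem F hF, by simpa using hK.apex_mem F hF⟩, by simp⟩
      · obtain ⟨htK, G, ⟨hG, hvG⟩, htG⟩ := Finset.mem_filter.1 ht
        refine ⟨⟨hK.insert_mem F hF G hG hvG t htK htG, ?_⟩, by simp⟩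
        rw [Finset.coe_insert]
        exact Set.insert_subset (hK.apex_mem F hF) (htG.trans (polyFaces_subset hG))
  rw [← Finset.sum_filter_add_sum_filter_not _ (fun s => v F ∈ s), h0, h1, Finset.sum_insert,
    Finset.sum_image, Finset.sum_add_distrib]
  · ring
  · intro s hs t ht hst
    rw [← Finset.erase_insert (hBv s hs), ← Finset.erase_insert (hBv t ht), hst]
  · intro h
    obtain ⟨t, ht, hte⟩ := Finset.mem_image.1 h
    obtain ⟨x, hx⟩ := hK.nonempty t (Finset.mem_filter.1 ht).1
    have : x ∈ ({v F} : Finset 𝔼) := hte ▸ Finset.mem_insert_of_mem hx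
    exact hBv t ht (Finset.mem_singleton.1 this ▸ hx)

theorem subsingleton_of_polyDim_eq_zero {F : Set 𝔼} (h : polyDim F = 0) : F.Subsingleton := by
  have := Submodule.finrank_eq_zero.1 h
  exact (vectorSpan_eq_bot_iff_subsingleton ℝ).1 this

open scoped Classical in
/-- The polytope number `F(n + 2)` is obtained by counting each simplex of the conical family in `F`
with the number `n.choose (dim s)` of interior points of the dilated simplex; the interior polytope
number counts only the simplices interior to `F`. -/
theorem IsConical.numbers {P : Set 𝔼} {v : Set 𝔼 → 𝔼} (hP : IsPolytope P)
    {K : Finset (Finset 𝔼)} (hK : IsConical P v K) :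
    ∀ F ∈ polyFaces P, ∀ n : ℕ,
      polytopeNumber v F (n + 2) =
        ∑ s ∈ K.filter (fun s : Finset 𝔼 => (s : Set 𝔼) ⊆ F), (n.choose (s.card - 1) : ℤ) ∧
      interiorNumber v F (n + 2) =
        ∑ s ∈ K.filter (fun s : Finset 𝔼 => IsCarrier F s), (n.choose (s.card - 1) : ℤ) := by
  intro F
  induction hd : polyDim F using Nat.strong_induction_on generalizing F with
  | _ d ih =>
  intro hF
  have hFpol := isPolytope_of_mem_polyFaces hP hF
  have hsplit : ∀ f : Finset 𝔼 → ℤ, ∑ s ∈ K.filter (fun s : Finset 𝔼 => (s : Set 𝔼) ⊆ F), f s =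
      ∑ s ∈ K.filter (fun s : Finset 𝔼 => IsCarrier F s), f s +
      ∑ s ∈ K.filter (fun s : Finset 𝔼 => ∃ G, (G ∈ polyFaces F ∧ G ≠ F) ∧ (s : Set 𝔼) ⊆ G),
        f s := by
    intro f
    rw [← Finset.sum_filter_add_sum_filter_not (K.filter fun s : Finset 𝔼 => (s : Set 𝔼) ⊆ F)
      (fun s => IsCarrier F s), Finset.filter_filter, Finset.filter_filter]
    congr 2 <;> refine Finset.filter_congr fun s _ => ?_
    · exact ⟨fun h => h.2, fun h => ⟨h.1, h⟩⟩
    · constructor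
      · rintro ⟨hsF, hc⟩
        by_contra! h
        exact hc ⟨hsF, fun G hG hsG => by_contra fun hne => h G ⟨hG, hne⟩ hsG⟩
      · rintro ⟨G, ⟨hG, hne⟩, hsG⟩
        exact ⟨hsG.trans (polyFaces_subset hG), fun hc => hne (hc.2 G hG hsG)⟩
  by_cases h0 : polyDim F = 0
  · have hsub := subsingleton_of_polyDim_eq_zero h0
    have hvF := hK.apex_mem F hF
    have huniq : ∀ s ∈ K, (s : Set 𝔼) ⊆ F ↔ s = {v F} := by
      intro s hs
      constructor
      · intro h
        exact (hK.nonempty s hs).subset_singleton_iff.1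
          fun x hx => Finset.mem_singleton.2 (hsub (h hx) hvF)
      · rintro rfl
        simpa using hvF
    have hcar : ∀ s ∈ K, IsCarrier F s ↔ s = {v F} := by
      intro s hs
      refine ⟨fun h => (huniq s hs).1 h.1, fun h => ⟨(huniq s hs).2 h, fun G hG _ => ?_⟩⟩
      exact face_eq_of_polyDim_le hG (by omega)
    intro n
    rw [polytopeNumber, interiorNumber, if_pos h0, if_pos h0, Finset.filter_congr huniq,
      Finset.filter_congr hcar, Finset.filter_eq', if_pos (hK.singleton_mem F hF)]
    simp
  · have hbase : ∀ n : ℕ, ∑ᶠ (G : Set 𝔼) (_ : (G ∈ polyFaces F ∧ G ≠ F) ∧ v F ∉ G),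
        interiorNumber v G (n + 2) =
        ∑ t ∈ K.filter (fun t : Finset 𝔼 => ∃ G, (G ∈ polyFaces F ∧ v F ∉ G) ∧ (t : Set 𝔼) ⊆ G),
          (n.choose (t.card - 1) : ℤ) := by
      intro n
      rw [← finsum_carrier hP hK.nonempty hF (fun G => G ∈ polyFaces F ∧ v F ∉ G) (fun G h => h.1)
        (fun G H hG hH hHG => ⟨hH, fun h => hG.2 (hHG h)⟩)]
      refine finsum_congr fun G => ?_
      have hiff : ((G ∈ polyFaces F ∧ G ≠ F) ∧ v F ∉ G) ↔ (G ∈ polyFaces F ∧ v F ∉ G) := by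
        refine ⟨fun h => ⟨h.1.1, h.2⟩, fun h => ⟨⟨h.1, ?_⟩, h.2⟩⟩
        rintro rfl
        exact h.2 (hK.apex_mem _ hF)
      refine finsum_congr_Prop (propext hiff) fun h => ?_
      have h' := hiff.2 h
      exact (ih _ (hd ▸ polyDim_lt h'.1.1 h'.1.2) G rfl (polyFaces_trans hP hF h'.1.1) n).2
    have hboundary : ∀ n : ℕ, ∑ᶠ (G : Set 𝔼) (_ : G ∈ polyFaces F ∧ G ≠ F),
        interiorNumber v G (n + 2) =
        ∑ t ∈ K.filter (fun t : Finset 𝔼 => ∃ G, (G ∈ polyFaces F ∧ G ≠ F) ∧ (t : Set 𝔼) ⊆ G),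
          (n.choose (t.card - 1) : ℤ) := by
      intro n
      rw [← finsum_carrier hP hK.nonempty hF (fun G => G ∈ polyFaces F ∧ G ≠ F) (fun G h => h.1)
        (fun G H hG hH hHG => ⟨hH, by
          rintro rfl
          exact hG.2 ((polyFaces_subset hG.1).antisymm hHG)⟩)]
      refine finsum_congr fun G => finsum_congr_Prop rfl fun h => ?_
      exact (ih _ (hd ▸ polyDim_lt h.1 h.2) G rfl (polyFaces_trans hP hF h.1) n).2
    have hpos : ∀ t ∈ K.filter fun t : Finset 𝔼 =>
        ∃ G, (G ∈ polyFaces F ∧ v F ∉ G) ∧ (t : Set 𝔼) ⊆ G,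
        ∃ k, t.card = k + 1 ∧ (insert (v F) t).card = k + 2 := by
      intro t ht
      obtain ⟨htK, G, ⟨-, hv⟩, htG⟩ := Finset.mem_filter.1 ht
      obtain ⟨k, hk⟩ := Nat.exists_eq_succ_of_ne_zero (hK.nonempty t htK).card_pos.ne'
      exact ⟨k, hk, by rw [Finset.card_insert_of_notMem fun h => hv (htG h), hk]⟩
    have hpoly : ∀ n : ℕ, polytopeNumber v F (n + 2) =
        ∑ s ∈ K.filter (fun s : Finset 𝔼 => (s : Set 𝔼) ⊆ F), (n.choose (s.card - 1) : ℤ) := by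
      intro n
      induction n with
      | zero =>
        rw [polytopeNumber, if_neg h0, hbase 0, hK.sum_face hF, polytopeNumber]
        simp only [Finset.card_singleton, Nat.sub_self, Nat.choose_self, Nat.cast_one]
        congr 1
        refine Finset.sum_congr rfl fun t ht => ?_
        obtain ⟨k, hk, hk'⟩ := hpos t ht
        simp [hk, hk']
      | succ n ihn =>
        rw [polytopeNumber, if_neg h0, hbase (n + 1), ihn, hK.sum_face hF, hK.sum_face hF,
          add_assoc, ← Finset.sum_add_distrib]
        congr 1
        · simp
        refine Finset.sum_congr rfl fun t ht => ?_
        obtain ⟨k, hk, hk'⟩ := hpos t ht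
        rw [hk, hk']
        simp only [Nat.add_sub_cancel, Nat.add_succ_sub_one, Nat.choose_succ_succ' n k]
        push_cast
        ring
    intro n
    refine ⟨hpoly n, ?_⟩
    rw [interiorNumber, if_neg h0, hboundary n, hpoly n, hsplit]
    ring

end Counting

/-! ### Generic points and pointed triangulations -/

section Generic

open Filter Topology

variable {m : ℕ}

local notation "𝔼" => EuclideanSpace ℝ (Fin m)

theorem line_mem_affineSubspace (A : AffineSubspace ℝ 𝔼) {x u : 𝔼} {a b : ℝ} (hab : a ≠ b)
    (ha : x + a • u ∈ A) (hb : x + b • u ∈ A) (t : ℝ) : x + t • u ∈ A := by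
  have h := A.smul_vsub_vadd_mem ((t - a) / (b - a)) hb ha ha
  have hne : b - a ≠ 0 := sub_ne_zero.2 hab.symm
  convert! h using 1
  rw [vsub_eq_sub, vadd_eq_add]
  match_scalars <;> field_simp <;> ring

/-- A line not contained in an affine subspace avoids it at all points close to, but different from,
any given point of the line. -/
theorem eventually_notMem_affineSubspace (A : AffineSubspace ℝ 𝔼) {x u : 𝔼} {t : ℝ}
    (h : x + t • u ∉ A) : ∀ᶠ ε : ℝ in 𝓝[>] 0, x + ε • u ∉ A := by
  have hsub : {ε : ℝ | x + ε • u ∈ A}.Subsingleton := by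
    intro a ha b hb
    by_contra hab
    exact h (line_mem_affineSubspace A hab ha hb t)
  have hfin : ({ε : ℝ | x + ε • u ∈ A} \ {0}).Finite := hsub.finite.subset Set.sdiff_subset
  have h0 : ({ε : ℝ | x + ε • u ∈ A} \ {0})ᶜ ∈ 𝓝 (0 : ℝ) :=
    hfin.isClosed.isOpen_compl.mem_nhds (by simp)
  filter_upwards [mem_nhdsWithin_of_mem_nhds h0, self_mem_nhdsWithin] with ε hε hpos hmem
  exact hε ⟨hmem, (Set.mem_Ioi.1 hpos).ne'⟩

/-- A convex set is not covered by finitely many affine subspaces unless one of them contains it. -/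
theorem exists_notMem_affineSubspaces {C : Set 𝔼} (hC : Convex ℝ C) (hne : C.Nonempty)
    {ι : Type*} (I : Finset ι) (A : ι → AffineSubspace ℝ 𝔼) (hA : ∀ i ∈ I, ¬ C ⊆ A i) :
    ∃ q ∈ C, ∀ i ∈ I, q ∉ A i := by
  classical
  induction I using Finset.induction_on with
  | empty => exact ⟨hne.some, hne.some_mem, by simp⟩
  | insert j I _ ih =>
    obtain ⟨p, hp, hpI⟩ := ih fun i hi => hA i (Finset.mem_insert_of_mem hi)
    obtain ⟨r, hr, hrj⟩ := Set.not_subset.1 (hA j (Finset.mem_insert_self j I))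
    have h1 : ∀ᶠ ε : ℝ in 𝓝[>] 0, ∀ i ∈ insert j I, p + ε • (r - p) ∉ A i := by
      rw [eventually_all_finset]
      intro i hi
      rcases Finset.mem_insert.1 hi with rfl | hi
      · exact eventually_notMem_affineSubspace (t := 1) _ (by simpa using hrj)
      · exact eventually_notMem_affineSubspace (t := 0) _ (by simpa using hpI i hi)
    have h2 : ∀ᶠ ε : ℝ in 𝓝[>] 0, ε ≤ 1 :=
      mem_nhdsWithin_of_mem_nhds (Iic_mem_nhds one_pos)
    obtain ⟨ε, ⟨hε, hle⟩, hpos⟩ := ((h1.and h2).and self_mem_nhdsWithin).exists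
    refine ⟨_, ?_, hε⟩
    exact hC.add_smul_sub_mem hp hr ⟨(Set.mem_Ioi.1 hpos).le, hle⟩

theorem card_le_polyDim_add_one {P : Set 𝔼} {s : Finset 𝔼} (hsP : (s : Set 𝔼) ⊆ P)
    (hs : AffineIndependent ℝ ((↑) : s → 𝔼)) : s.card ≤ polyDim P + 1 := by
  rcases s.eq_empty_or_nonempty with rfl | hne
  · simp
  have := hne.to_subtype
  have h := hs.finrank_vectorSpan_add_one
  rw [Subtype.range_coe_subtype, Fintype.card_coe] at h
  rw [← h]
  exact Nat.succ_le_succ (Submodule.finrank_mono (vectorSpan_mono ℝ hsP))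

theorem polyDim_lt_card {P : Set 𝔼} {s : Finset 𝔼} (hs : s.Nonempty)
    (h : P ⊆ affineSpan ℝ (s : Set 𝔼)) : polyDim P < s.card := by
  have := hs.to_subtype
  have h1 := finrank_vectorSpan_range_add_one_le ℝ (p := ((↑) : s → 𝔼))
  rw [Subtype.range_coe_subtype, Fintype.card_coe] at h1
  refine lt_of_lt_of_le (Nat.lt_succ_of_le ?_) h1
  have h2 := vectorSpan_mono ℝ h
  have h3 : vectorSpan ℝ (affineSpan ℝ (s : Set 𝔼) : Set 𝔼) = vectorSpan ℝ (s : Set 𝔼) := by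
    rw [← direction_affineSpan, AffineSubspace.affineSpan_coe, direction_affineSpan]
  rw [h3] at h2
  exact Submodule.finrank_mono h2

/-- A point in general position with respect to a complex triangulating `P`: it avoids the affine
hulls of all simplices of dimension less than `dim P`. -/
def IsGeneric (P : Set 𝔼) (K : Geometry.SimplicialComplex ℝ 𝔼) (q : 𝔼) : Prop :=
  q ∈ P ∧ ∀ s ∈ K.faces, s.card ≤ polyDim P → q ∉ affineSpan ℝ (s : Set 𝔼)

theorem exists_isGeneric {P : Set 𝔼} (hP : Convex ℝ P) (hne : P.Nonempty)
    {K : Geometry.SimplicialComplex ℝ 𝔼} (hK : K.faces.Finite) : ∃ q, IsGeneric P K q := by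
  classical
  obtain ⟨q, hq, h⟩ := exists_notMem_affineSubspaces hP hne
    (hK.toFinset.filter fun s => s.card ≤ polyDim P) (fun s => affineSpan ℝ (s : Set 𝔼)) (by
      intro s hs hsub
      simp only [Finset.mem_filter, Set.Finite.mem_toFinset] at hs
      exact absurd hs.2 (not_le.2 (polyDim_lt_card (K.nonempty_of_mem_faces hs.1) hsub)))
  exact ⟨q, hq, fun s hs hc => h s (by simp [hs, hc])⟩

/-- Moving from a point `y` of the triangulated polytope a little towards a generic point, or a
little away from it when that is possible, leads into a full-dimensional simplex containing `y`. -/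
theorem exists_fullSimplex {P : Set 𝔼} (hP : Convex ℝ P) {K : Geometry.SimplicialComplex ℝ 𝔼}
    (hK : K.faces.Finite) (hspace : K.space = P) {y u : 𝔼} (hy : y ∈ P) (hu : IsFeasible P y u)
    {t : ℝ} (ht : ∀ s ∈ K.faces, s.card ≤ polyDim P → y + t • u ∉ affineSpan ℝ (s : Set 𝔼)) :
    ∃ S ∈ K.faces, S.card = polyDim P + 1 ∧ y ∈ convexHull ℝ (S : Set 𝔼) ∧
      ∃ ε : ℝ, 0 < ε ∧ y + ε • u ∈ convexHull ℝ (S : Set 𝔼) := by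
  have h1 : ∀ᶠ ε : ℝ in 𝓝[>] 0, ∀ s ∈ K.faces, s.card ≤ polyDim P →
      y + ε • u ∉ affineSpan ℝ (s : Set 𝔼) := by
    rw [eventually_all_finite hK]
    intro s hs
    by_cases hc : s.card ≤ polyDim P
    · filter_upwards [eventually_notMem_affineSubspace _ (ht s hs hc)] with ε hε _ using hε
    · exact Eventually.of_forall fun ε h => absurd h hc
  have h2 : ∀ᶠ ε : ℝ in 𝓝[>] 0, ∀ s ∈ K.faces, y + ε • u ∈ convexHull ℝ (s : Set 𝔼) →
      y ∈ convexHull ℝ (s : Set 𝔼) := by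
    rw [eventually_all_finite hK]
    intro s hs
    by_cases hys : y ∈ convexHull ℝ (s : Set 𝔼)
    · exact Eventually.of_forall fun _ _ => hys
    · have hopen := (s.finite_toSet.isClosed_convexHull ℝ).isOpen_compl
      have hcont : Continuous fun ε : ℝ => y + ε • u := by fun_prop
      have := (hopen.preimage hcont).mem_nhds (x := 0) (by simpa using hys)
      filter_upwards [mem_nhdsWithin_of_mem_nhds this] with ε hε hmem using absurd hmem hε
  have h3 : ∀ᶠ ε : ℝ in 𝓝[>] 0, y + ε • u ∈ P := by
    obtain ⟨δ, hδ, hmem⟩ := hu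
    filter_upwards [mem_nhdsWithin_of_mem_nhds (Iic_mem_nhds hδ), self_mem_nhdsWithin]
      with ε hle hpos
    have := hP.add_smul_mem hy hmem (t := ε / δ)
      ⟨div_nonneg (Set.mem_Ioi.1 hpos).le hδ.le, (div_le_one hδ).2 hle⟩
    rwa [smul_smul, div_mul_cancel₀ _ hδ.ne'] at this
  obtain ⟨ε, ⟨⟨⟨h1, h2⟩, h3⟩, hpos⟩⟩ := (((h1.and h2).and h3).and self_mem_nhdsWithin).exists
  rw [← hspace] at h3
  obtain ⟨S, hS, hmem⟩ := Geometry.SimplicialComplex.mem_space_iff.1 h3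
  refine ⟨S, hS, le_antisymm (card_le_polyDim_add_one ?_ (K.indep hS)) ?_, h2 S hS hmem, ε, hpos,
    hmem⟩
  · rw [← hspace]
    exact Geometry.SimplicialComplex.subset_space hS
  · by_contra hlt
    exact h1 S hS (by omega) (convexHull_subset_affineSpan _ hmem)

/-- The simplices of `K` contained in `F`. -/
def subcomplexIn (K : Geometry.SimplicialComplex ℝ 𝔼) (F : Set 𝔼) :
    Geometry.SimplicialComplex ℝ 𝔼 where
  faces := {s | s ∈ K.faces ∧ (s : Set 𝔼) ⊆ F}
  isRelLowerSet_faces := fun _ hs => ⟨K.nonempty_of_mem_faces hs.1, fun _ hts ht =>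
    ⟨K.down_closed hs.1 hts ht, (Finset.coe_subset.2 hts).trans hs.2⟩⟩
  indep hs := K.indep hs.1
  inter_subset_convexHull hs ht := K.inter_subset_convexHull hs.1 ht.1

theorem subcomplexIn_space {P F : Set 𝔼} (hP : IsPolytope P)
    {K : Geometry.SimplicialComplex ℝ 𝔼} (hspace : K.space = P) (hF : F ∈ polyFaces P) :
    (subcomplexIn K F).space = F := by
  ext x
  rw [Geometry.SimplicialComplex.mem_space_iff]
  constructor
  · rintro ⟨s, hs, hx⟩
    exact convexHull_min hs.2 (convex_of_mem_polyFaces hP hF) hx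
  · intro hx
    have hxK : x ∈ K.space := by rw [hspace]; exact polyFaces_subset hF hx
    obtain ⟨s, hs, hxs⟩ := exists_openSimplex_of_mem_space hxK
    have hsP : (s : Set 𝔼) ⊆ P := by
      rw [← hspace]; exact Geometry.SimplicialComplex.subset_space hs
    exact ⟨s, ⟨hs, subset_face_of_mem_openSimplex hF hsP hxs hx⟩,
      openSimplex_subset_convexHull s hxs⟩

/-- In a pointed triangulation every point of a face `F` lies in a simplex of `F` having the apex of
`F` as a vertex: full-dimensional simplices contain the apex, and they cover `F`. -/
theorem IsPointedTriangulation.exists_star {P F : Set 𝔼} (hP : IsPolytope P)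
    {K : Geometry.SimplicialComplex ℝ 𝔼} {v : Set 𝔼 → 𝔼} (h : IsPointedTriangulation P K v)
    (hF : F ∈ polyFaces P) {y : 𝔼} (hy : y ∈ F) :
    ∃ S ∈ K.faces, v F ∈ S ∧ y ∈ convexHull ℝ (S : Set 𝔼) := by
  have hconv := convex_of_mem_polyFaces hP hF
  have hfin : (subcomplexIn K F).faces.Finite := h.finite.subset fun s hs => hs.1
  obtain ⟨q, hqF, hq⟩ := exists_isGeneric hconv hF.2 hfin
  obtain ⟨S, hS, hcard, hyS, -⟩ := exists_fullSimplex hconv hfin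
    (subcomplexIn_space hP h.space_eq hF) hy (isFeasible_sub hqF) (t := 1) (by simpa using hq)
  have hSF : convexHull ℝ (S : Set 𝔼) ⊆ F := convexHull_min hS.2 hconv
  have hv := h.apex_mem F hF S hS.1 hSF hcard
  exact ⟨S, hS.1, Finset.mem_coe.1 (extremePoints_convexHull_subset
    (inter_extremePoints_subset_extremePoints_of_subset hSF ⟨hv, h.apex_vertex F hF⟩)), hyS⟩

/-- A finite complex in which the star of each apex `v F` covers `F` is a conical family. -/
theorem isConical_of_star {P : Set 𝔼} (hP : IsPolytope P)
    {K : Geometry.SimplicialComplex ℝ 𝔼} (hK : K.faces.Finite)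
    (hsub : ∀ s ∈ K.faces, (s : Set 𝔼) ⊆ P) {v : Set 𝔼 → 𝔼} (hv : ∀ F ∈ polyFaces P, v F ∈ F)
    (hstar : ∀ F ∈ polyFaces P, ∀ y ∈ F, ∃ S ∈ K.faces, v F ∈ S ∧
      y ∈ convexHull ℝ (S : Set 𝔼)) : IsConical P v hK.toFinset := by
  refine ⟨?_, ?_, ?_, ?_, ?_, ?_⟩ <;> try simp only [Set.Finite.mem_toFinset]
  · exact fun s hs => K.nonempty_of_mem_faces hs
  · exact hsub
  · exact hv
  · intro F hF
    obtain ⟨S, hS, hvS, -⟩ := hstar F hF _ (hv F hF)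
    exact K.down_closed hS (by simpa using hvS) (Finset.singleton_nonempty _)
  · intro F hF G hG _ t ht htG
    obtain ⟨x, hx⟩ := openSimplex_nonempty (K.nonempty_of_mem_faces ht)
    have hxF : x ∈ F := convexHull_min (htG.trans (polyFaces_subset hG))
      (convex_of_mem_polyFaces hP hF) (openSimplex_subset_convexHull t hx)
    obtain ⟨S, hS, hvS, hxS⟩ := hstar F hF _ hxF
    exact K.down_closed hS (Finset.insert_subset hvS
      (subset_of_mem_openSimplex_of_mem_convexHull ht hS hx hxS)) (Finset.insert_nonempty _ _)
  · intro F hF s hs hsF hne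
    have hne' : (s.erase (v F)).Nonempty := by
      rw [Finset.nonempty_iff_ne_empty]
      intro he
      rcases Finset.erase_eq_empty_iff _ _ |>.1 he with h0 | h1
      · exact (K.nonempty_of_mem_faces hs).ne_empty h0
      · exact hne h1
    have hsub : s.erase (v F) ⊆ s := Finset.erase_subset _ _
    have he : s.erase (v F) ∈ K.faces := K.down_closed hs hsub hne'
    refine ⟨he, ?_⟩
    have hFpol := isPolytope_of_mem_polyFaces hP hF
    obtain ⟨x, hx⟩ := openSimplex_nonempty hne'
    have heF : ((s.erase (v F) : Finset 𝔼) : Set 𝔼) ⊆ F := (Finset.coe_subset.2 hsub).trans hsF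
    have hxF : x ∈ F := convexHull_min heF hFpol.convex (openSimplex_subset_convexHull _ hx)
    refine ⟨carrierFace F x, carrierFace_mem_polyFaces hFpol hxF, ?_,
      (isCarrier_carrierFace hFpol heF hx).1⟩
    -- If the carrier of `x` contained the apex, then `x` would lie on an open segment from the apex
    -- to a point of the star, so that the apex would be a vertex of the simplex around `x`.
    rintro ⟨-, ε, hε, hz⟩
    obtain ⟨S, hS, hvS, hzS⟩ := hstar F hF _ hz
    obtain ⟨t, htS, hzt⟩ := exists_openSimplex_of_mem_convexHull hzS
    have hxi := mem_openSimplex_insert (v := v F) hzt (a := ε / (1 + ε)) (by positivity)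
      ((div_lt_one (by positivity)).2 (by linarith))
    have hxe : (ε / (1 + ε)) • v F + (1 - ε / (1 + ε)) • (x + ε • (x - v F)) = x := by
      match_scalars <;> field_simp <;> ring
    rw [hxe] at hxi
    have heq := eq_of_mem_openSimplex he
      (K.down_closed hS (Finset.insert_subset hvS htS) (Finset.insert_nonempty _ _)) hx hxi
    exact Finset.notMem_erase (v F) s (heq ▸ Finset.mem_insert_self _ _)

/-- The simplices of a pointed triangulation form a conical family. -/
theorem IsPointedTriangulation.isConical {P : Set 𝔼} (hP : IsPolytope P)
    {K : Geometry.SimplicialComplex ℝ 𝔼} {v : Set 𝔼 → 𝔼} (h : IsPointedTriangulation P K v) :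
    IsConical P v h.finite.toFinset := by
  refine isConical_of_star hP h.finite (fun s hs => ?_) (fun F hF => (h.apex_vertex F hF).1)
    fun F hF y hy => h.exists_star hP hF hy
  rw [← h.space_eq]
  exact Geometry.SimplicialComplex.subset_space hs

end Generic

/-! ### Half-open decompositions -/

section HalfOpenCounting

/-- If every member of `T` lies in exactly one of the intervals from `A S` to `S`, where `S` runs
over the `D`-element sets in `𝒮`, then a sum over `T` depending only on cardinalities can be
evaluated interval by interval. -/
theorem sum_interval_partition {α : Type*} [DecidableEq α] {𝒮 T : Finset (Finset α)}
    {A : Finset α → Finset α} {D : ℕ} (hA : ∀ S ∈ 𝒮, A S ⊆ S) (hD : ∀ S ∈ 𝒮, S.card = D)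
    (huniq : ∀ s ∈ T, ∃! S, S ∈ 𝒮 ∧ A S ⊆ s ∧ s ⊆ S)
    (hmem : ∀ S ∈ 𝒮, ∀ s, A S ⊆ s → s ⊆ S → s ∈ T) (f : ℕ → ℤ) :
    ∑ s ∈ T, f s.card = ∑ S ∈ 𝒮, ∑ j ∈ Finset.range (D - (A S).card + 1),
      ((D - (A S).card).choose j : ℤ) * f ((A S).card + j) := by
  have hT : T = 𝒮.biUnion fun S => Finset.Icc (A S) S := by
    ext s
    simp only [Finset.mem_biUnion, Finset.mem_Icc]
    constructor
    · intro hs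
      obtain ⟨S, hS, -⟩ := huniq s hs
      exact ⟨S, hS⟩
    · rintro ⟨S, hS, h1, h2⟩
      exact hmem S hS s h1 h2
  rw [hT, Finset.sum_biUnion]
  · refine Finset.sum_congr rfl fun S hS => ?_
    rw [Finset.Icc_eq_image_powerset (hA S hS), Finset.sum_image]
    · have hcard : (S \ A S).card = D - (A S).card := by
        rw [Finset.card_sdiff_of_subset (hA S hS), hD S hS]
      rw [← hcard]
      simp_rw [← nsmul_eq_mul]
      rw [← Finset.sum_powerset_apply_card (fun j => f ((A S).card + j))]
      refine Finset.sum_congr rfl fun t ht => ?_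
      rw [Finset.card_union_of_disjoint]
      exact Finset.disjoint_sdiff.mono_right (Finset.mem_powerset.1 ht)
    · intro t ht t' ht' h
      have hd : ∀ t ∈ (S \ A S).powerset, (A S ∪ t) \ A S = t := fun t ht =>
        Finset.union_sdiff_cancel_left
          (Finset.disjoint_sdiff.mono_right (Finset.mem_powerset.1 ht))
      rw [← hd t ht, ← hd t' ht']
      exact congrArg (· \ A S) h
  · intro S hS S' hS' hne
    rw [Function.onFun, Finset.disjoint_left]
    intro s hs hs'
    rw [Finset.mem_Icc] at hs hs'
    exact hne ((huniq s (hmem S hS s hs.1 hs.2)).unique ⟨hS, hs⟩ ⟨hS', hs'⟩)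

/-- The alternating sum that recovers the `h`-vector from the `f`-vector of one half-open
simplex. -/
theorem sum_hComponent_interval {a D k : ℕ} (ha : a ≤ D) (hk : k ≤ D) :
    ∑ j ∈ Finset.range (D - a + 1), ((D - a).choose j : ℤ) *
      (if a + j ≤ k then (-1) ^ (k - (a + j)) * ((D - (a + j)).choose (D - k) : ℤ) else 0) =
      if a = k then 1 else 0 := by
  rcases lt_or_ge k a with hka | hak
  · rw [if_neg hka.ne']
    refine Finset.sum_eq_zero fun j _ => ?_
    rw [if_neg (by omega), mul_zero]
  obtain ⟨r, rfl⟩ := Nat.exists_eq_add_of_le hak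
  obtain ⟨N, rfl⟩ := Nat.exists_eq_add_of_le ha
  have hr : r ≤ N := by omega
  have hsub : Finset.range (r + 1) ⊆ Finset.range (a + N - a + 1) :=
    Finset.range_mono (by omega)
  rw [← Finset.sum_subset hsub fun j _ hj => by
    rw [Finset.mem_range] at hj
    rw [if_neg (by omega), mul_zero]]
  have hterm : ∀ j ∈ Finset.range (r + 1), ((a + N - a).choose j : ℤ) *
      (if a + j ≤ a + r then (-1) ^ (a + r - (a + j)) *
        ((a + N - (a + j)).choose (a + N - (a + r)) : ℤ) else 0) =
      (N.choose r : ℤ) * (-1) ^ r * ((-1) ^ j * (r.choose j : ℤ)) := by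
    intro j hj
    have hjr : j ≤ r := Nat.lt_succ_iff.1 (Finset.mem_range.1 hj)
    rw [if_pos (by omega), Nat.add_sub_cancel_left, Nat.add_sub_add_left, Nat.add_sub_add_left,
      Nat.add_sub_add_left, ← Nat.choose_symm_of_eq_add (n := N - j) (a := r - j) (b := N - r)
      (by omega)]
    have h1 : (N.choose r : ℤ) * (r.choose j : ℤ) = N.choose j * ((N - j).choose (r - j) : ℤ) := by
      exact_mod_cast Nat.choose_mul hjr
    have h2 : (-1 : ℤ) ^ r * (-1) ^ j = (-1) ^ (r - j) := by
      obtain ⟨i, rfl⟩ := Nat.exists_eq_add_of_le hjr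
      rw [Nat.add_sub_cancel_left, pow_add, mul_right_comm, ← mul_pow]
      simp
    rw [← h2]
    linear_combination (-(-1 : ℤ) ^ r * (-1) ^ j) * h1
  rw [Finset.sum_congr rfl hterm, ← Finset.mul_sum, Int.alternating_sum_range_choose]
  rcases eq_or_ne r 0 with rfl | hr0
  · simp
  · simp [hr0]

/-- Vandermonde's identity, in the form that sums the interior points of the dilated simplices in an
interval of faces. -/
theorem sum_choose_interval (n a p : ℕ) (hp : 1 ≤ p) :
    ∑ j ∈ Finset.range (a + 1), (a.choose j : ℤ) * (n.choose (p + j - 1) : ℤ) =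
      ((n + a).choose (a + p - 1) : ℤ) := by
  have h := Nat.add_choose_eq a n (a + p - 1)
  rw [Finset.Nat.sum_antidiagonal_eq_sum_range_succ_mk] at h
  rw [add_comm n a, h, ← Finset.sum_range_reflect]
  push_cast
  have hsub : Finset.range (a + 1) ⊆ Finset.range (a + p - 1).succ :=
    Finset.range_mono (by omega)
  rw [← Finset.sum_subset hsub fun j _ hj => by
    rw [Finset.mem_range] at hj
    rw [Nat.choose_eq_zero_of_lt (by omega), Nat.cast_zero, zero_mul]]
  refine Finset.sum_congr rfl fun j hj => ?_
  have hj' := Finset.mem_range.1 hj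
  rw [Nat.choose_symm (by omega),
    show p + (a - j) - 1 = a + p - 1 - j by omega]

end HalfOpenCounting

section HalfOpenSimplices

open Filter Topology

variable {m : ℕ}

local notation "𝔼" => EuclideanSpace ℝ (Fin m)

theorem sum_smul_mem_affineSpan {s : Finset 𝔼} {c : 𝔼 → ℝ} (hc : ∑ i ∈ s, c i = 1) :
    ∑ i ∈ s, c i • i ∈ affineSpan ℝ (s : Set 𝔼) := by
  have h := affineCombination_mem_affineSpan (k := ℝ) (s := s.attach) (w := fun i => c i)
    (by rw [Finset.sum_attach s c, hc]) (fun i : s => (i : 𝔼))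
  rw [Finset.affineCombination_eq_linear_combination _ _ _ (by rw [Finset.sum_attach s c, hc]),
    Finset.sum_attach s (fun i => c i • i), Subtype.range_coe_subtype] at h
  exact h

theorem exists_weights_of_mem_affineSpan {s : Finset 𝔼} {q : 𝔼}
    (h : q ∈ affineSpan ℝ (s : Set 𝔼)) :
    ∃ c : 𝔼 → ℝ, ∑ i ∈ s, c i = 1 ∧ ∑ i ∈ s, c i • i = q := by
  classical
  have hr : (s : Set 𝔼) = Set.range ((↑) : s → 𝔼) := by simp
  rw [hr] at h
  obtain ⟨w, hw, rfl⟩ := eq_affineCombination_of_mem_affineSpan_of_fintype h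
  refine ⟨fun i => if hi : i ∈ s then w ⟨i, hi⟩ else 0, ?_, ?_⟩
  · rw [← hw, ← Finset.sum_coe_sort s]
    exact Finset.sum_congr rfl fun i _ => by simp
  · rw [Finset.affineCombination_eq_linear_combination _ _ _ hw, ← Finset.sum_coe_sort s]
    exact Finset.sum_congr rfl fun i _ => by simp

/-- A generic point has nonzero barycentric coordinates with respect to every full-dimensional
simplex of the triangulation. -/
theorem IsGeneric.exists_coords {P : Set 𝔼} {K : Geometry.SimplicialComplex ℝ 𝔼}
    (hspace : K.space = P) {q : 𝔼} (hq : IsGeneric P K q) (hd : 1 ≤ polyDim P) :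
    ∃ c : Finset 𝔼 → 𝔼 → ℝ, ∀ S ∈ K.faces, S.card = polyDim P + 1 →
      ∑ i ∈ S, c S i = 1 ∧ ∑ i ∈ S, c S i • i = q ∧ ∀ i ∈ S, c S i ≠ 0 := by
  classical
  have key : ∀ S : Finset 𝔼, ∃ c : 𝔼 → ℝ, S ∈ K.faces → S.card = polyDim P + 1 →
      ∑ i ∈ S, c i = 1 ∧ ∑ i ∈ S, c i • i = q ∧ ∀ i ∈ S, c i ≠ 0 := by
    intro S
    by_cases hS : S ∈ K.faces ∧ S.card = polyDim P + 1
    swap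
    · exact ⟨0, fun h1 h2 => absurd ⟨h1, h2⟩ hS⟩
    obtain ⟨hS, hcard⟩ := hS
    have hSP : (S : Set 𝔼) ⊆ P := by
      rw [← hspace]; exact Geometry.SimplicialComplex.subset_space hS
    have hspan : affineSpan ℝ (S : Set 𝔼) = affineSpan ℝ P := by
      have h := (K.indep hS).affineSpan_eq_of_le_of_card_eq_finrank_add_one
        (sp := affineSpan ℝ P) (by simpa using affineSpan_mono ℝ hSP)
        (by rw [direction_affineSpan, Fintype.card_coe, hcard, polyDim])
      simpa using h
    obtain ⟨c, h1, h2⟩ := exists_weights_of_mem_affineSpan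
      (hspan.symm ▸ subset_affineSpan ℝ P hq.1 : q ∈ affineSpan ℝ (S : Set 𝔼))
    refine ⟨c, fun _ _ => ⟨h1, h2, fun i hi h0 => ?_⟩⟩
    have hcard' := Finset.card_erase_of_mem hi
    refine hq.2 (S.erase i) (K.down_closed hS (S.erase_subset i)
      (Finset.card_pos.1 (by omega))) (by omega) ?_
    rw [← h2, ← Finset.add_sum_erase _ _ hi, h0, zero_smul, zero_add]
    rw [← Finset.add_sum_erase _ _ hi, h0, zero_add] at h1
    exact sum_smul_mem_affineSpan h1
  choose c hc using key
  exact ⟨c, hc⟩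

theorem eventually_mem_openSimplex {s S : Finset 𝔼} (hsS : s ⊆ S) {y : 𝔼}
    (hy : y ∈ openSimplex s) {c : 𝔼 → ℝ} (hc : ∑ i ∈ S, c i = 1) {σ : ℝ}
    (hσ : ∀ i ∈ S, i ∉ s → 0 < σ * c i) :
    ∀ᶠ ε : ℝ in 𝓝[>] 0, y + ε • (σ • (∑ i ∈ S, c i • i - y)) ∈ openSimplex S := by
  classical
  obtain ⟨w, hw, hw1, hw2⟩ := hy
  have hw1' : ∑ i ∈ S, (if i ∈ s then w i else 0) = 1 := by
    rw [← Finset.sum_filter, Finset.filter_mem_eq_inter, Finset.inter_eq_right.2 hsS, hw1]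
  have hw2' : ∑ i ∈ S, (if i ∈ s then w i else 0) • i = y := by
    simp only [ite_smul, zero_smul]
    rw [← Finset.sum_filter, Finset.filter_mem_eq_inter, Finset.inter_eq_right.2 hsS, hw2]
  have hpos : ∀ᶠ ε : ℝ in 𝓝[>] 0, ∀ i ∈ S,
      0 < (1 - ε * σ) * (if i ∈ s then w i else 0) + ε * σ * c i := by
    rw [eventually_all_finset]
    intro i hi
    by_cases his : i ∈ s
    · simp only [if_pos his]
      have hcont : Continuous fun ε : ℝ => (1 - ε * σ) * w i + ε * σ * c i := by fun_prop
      refine mem_nhdsWithin_of_mem_nhds ((isOpen_Ioi.preimage hcont).mem_nhds ?_)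
      simpa using hw i his
    · filter_upwards [self_mem_nhdsWithin] with ε hε
      rw [if_neg his, mul_zero, zero_add, mul_assoc]
      exact mul_pos hε (hσ i hi his)
  filter_upwards [hpos] with ε hε
  refine ⟨_, hε, ?_, ?_⟩
  · rw [Finset.sum_add_distrib, ← Finset.mul_sum, ← Finset.mul_sum, hw1', hc]
    ring
  · simp only [add_smul, mul_smul, Finset.sum_add_distrib, ← Finset.smul_sum]
    rw [hw2']
    module

/-- The simplex `s` has a unique full-dimensional coface into which one gets by moving from the
interior of `s` a little towards the generic point `q` (when `σ = 1`) or away from it (when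
`σ = -1`). In terms of the barycentric coordinates `c S` of `q`, it is characterized by the signs
of the coordinates at the vertices outside `s`. -/
theorem existsUnique_fullSimplex {P : Set 𝔼} (hP : Convex ℝ P)
    {K : Geometry.SimplicialComplex ℝ 𝔼} (hK : K.faces.Finite) (hspace : K.space = P) {q : 𝔼}
    (hq : IsGeneric P K q) {c : Finset 𝔼 → 𝔼 → ℝ}
    (hc : ∀ S ∈ K.faces, S.card = polyDim P + 1 →
      ∑ i ∈ S, c S i = 1 ∧ ∑ i ∈ S, c S i • i = q ∧ ∀ i ∈ S, c S i ≠ 0)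
    {σ : ℝ} (hσ : σ ≠ 0) {s : Finset 𝔼} (hs : s ∈ K.faces) {y : 𝔼} (hy : y ∈ openSimplex s)
    (hfeas : IsFeasible P y (σ • (q - y))) :
    ∃! S, (S ∈ K.faces ∧ S.card = polyDim P + 1) ∧ s ⊆ S ∧ ∀ i ∈ S, i ∉ s → 0 < σ * c S i := by
  classical
  have hsP : (s : Set 𝔼) ⊆ P := by
    rw [← hspace]; exact Geometry.SimplicialComplex.subset_space hs
  have hyP : y ∈ P := convexHull_min hsP hP (openSimplex_subset_convexHull s hy)
  obtain ⟨S, hS, hcard, hyS, ε, hε, hz⟩ := exists_fullSimplex hP hK hspace hyP hfeas (t := σ⁻¹) (by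
    rw [smul_smul, inv_mul_cancel₀ hσ, one_smul, add_sub_cancel]
    exact hq.2)
  obtain ⟨h1, h2, h0⟩ := hc S hS hcard
  have hsS := subset_of_mem_openSimplex_of_mem_convexHull hs hS hy hyS
  have hpos : ∀ i ∈ S, i ∉ s → 0 < σ * c S i := by
    intro i hi his
    obtain ⟨w, hw, hw1, hw2⟩ := hy
    have hw1' : ∑ i ∈ S, (if i ∈ s then w i else 0) = 1 := by
      rw [← Finset.sum_filter, Finset.filter_mem_eq_inter, Finset.inter_eq_right.2 hsS, hw1]
    have hw2' : ∑ i ∈ S, (if i ∈ s then w i else 0) • i = y := by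
      simp only [ite_smul, zero_smul]
      rw [← Finset.sum_filter, Finset.filter_mem_eq_inter, Finset.inter_eq_right.2 hsS, hw2]
    obtain ⟨b, hb, hb1, hb2⟩ := Finset.mem_convexHull'.1 hz
    have heq := (K.indep hS).eq_of_sum_eq_sum_subtype
      (w₁ := fun i => (1 - ε * σ) * (if i ∈ s then w i else 0) + ε * σ * c S i) (w₂ := b)
      (by
        rw [Finset.sum_add_distrib, ← Finset.mul_sum, ← Finset.mul_sum, hw1', h1, hb1]
        ring)
      (by
        simp only [add_smul, mul_smul, Finset.sum_add_distrib, ← Finset.smul_sum]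
        rw [hw2', h2, hb2]
        module) i hi
    simp only [if_neg his, mul_zero, zero_add] at heq
    have hnn := hb i hi
    rw [← heq, mul_assoc] at hnn
    exact lt_of_le_of_ne (nonneg_of_mul_nonneg_right hnn hε) (mul_ne_zero hσ (h0 i hi)).symm
  refine ⟨S, ⟨⟨hS, hcard⟩, hsS, hpos⟩, ?_⟩
  rintro S' ⟨⟨hS', hcard'⟩, hsS', hpos'⟩
  obtain ⟨h1', h2', -⟩ := hc S' hS' hcard'
  have e1 := eventually_mem_openSimplex hsS hy h1 hpos
  have e2 := eventually_mem_openSimplex hsS' hy h1' hpos'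
  rw [h2] at e1
  rw [h2'] at e2
  obtain ⟨δ, hδ, hδ'⟩ := (e1.and e2).exists
  exact eq_of_mem_openSimplex hS' hS hδ' hδ

end HalfOpenSimplices

/-! ### The interior polytope numbers and the `h`-vector -/

section HVector

variable {m : ℕ}

local notation "𝔼" => EuclideanSpace ℝ (Fin m)

theorem IsGeneric.face_eq {P : Set 𝔼} (hP : IsPolytope P) {K : Geometry.SimplicialComplex ℝ 𝔼}
    (hspace : K.space = P) {q : 𝔼} (hq : IsGeneric P K q) {G : Set 𝔼} (hG : G ∈ polyFaces P)
    (hqG : q ∈ G) : G = P := by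
  by_contra hne
  have hlt := polyDim_lt hG hne
  rw [← subcomplexIn_space hP hspace hG] at hqG
  obtain ⟨s, hs, hqs⟩ := Geometry.SimplicialComplex.mem_space_iff.1 hqG
  have := card_le_polyDim_add_one hs.2 (K.indep hs.1)
  exact hq.2 s hs.1 (by omega) (convexHull_subset_affineSpan _ hqs)

/-- A simplex is interior to `P` if and only if one can move from its interior a little away from a
generic point without leaving `P`. -/
theorem isCarrier_iff_isFeasible {P : Set 𝔼} (hP : IsPolytope P)
    {K : Geometry.SimplicialComplex ℝ 𝔼} (hspace : K.space = P) {q : 𝔼} (hq : IsGeneric P K q)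
    {s : Finset 𝔼} (hsP : (s : Set 𝔼) ⊆ P) {y : 𝔼} (hy : y ∈ openSimplex s) :
    IsCarrier P s ↔ IsFeasible P y ((-1 : ℝ) • (q - y)) := by
  have hyP : y ∈ P := convexHull_min hsP hP.convex (openSimplex_subset_convexHull s hy)
  have hF := carrierFace_mem_polyFaces hP hyP
  rw [neg_one_smul, neg_sub]
  constructor
  · intro h
    have := h.2 _ hF (isCarrier_carrierFace hP hsP hy).1
    have hqF : q ∈ carrierFace P y := by rw [this]; exact hq.1
    exact hqF.2
  · intro h
    have hcar := isCarrier_carrierFace hP hsP hy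
    rwa [hq.face_eq hP hspace hF ⟨hq.1, h⟩] at hcar

section Coordinates

variable {P : Set (EuclideanSpace ℝ (Fin m))}
  {K : Geometry.SimplicialComplex ℝ (EuclideanSpace ℝ (Fin m))} {q : EuclideanSpace ℝ (Fin m)}
  {c : Finset (EuclideanSpace ℝ (Fin m)) → EuclideanSpace ℝ (Fin m) → ℝ}

/-- The intervals from the vertices of `S` at which the generic point has negative barycentric
coordinate to `S`, for `S` full-dimensional, partition the complex together with its empty
simplex. -/
theorem sum_faces_eq (hP : Convex ℝ P) (hK : K.faces.Finite) (hspace : K.space = P)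
    (hq : IsGeneric P K q)
    (hc : ∀ S ∈ K.faces, S.card = polyDim P + 1 →
      ∑ i ∈ S, c S i = 1 ∧ ∑ i ∈ S, c S i • i = q ∧ ∀ i ∈ S, c S i ≠ 0) (f : ℕ → ℤ) :
    ∑ s ∈ insert ∅ hK.toFinset, f s.card =
      ∑ S ∈ hK.toFinset.filter (fun S => S.card = polyDim P + 1),
        ∑ j ∈ Finset.range (polyDim P + 1 - (S.filter (c S · < 0)).card + 1),
          ((polyDim P + 1 - (S.filter (c S · < 0)).card).choose j : ℤ) *
            f ((S.filter (c S · < 0)).card + j) := by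
  refine sum_interval_partition (A := fun S => S.filter (c S · < 0))
    (fun S _ => S.filter_subset _) (fun S hS => (Finset.mem_filter.1 hS).2) ?_ ?_ f
  · intro s hs
    have hiff : ∀ S, (S ∈ hK.toFinset.filter (fun S => S.card = polyDim P + 1) ∧
        S.filter (c S · < 0) ⊆ s ∧ s ⊆ S) ↔ (S ∈ K.faces ∧ S.card = polyDim P + 1) ∧
        s ⊆ S ∧ ∀ i ∈ S, i ∉ s → 0 < 1 * c S i := by
      intro S
      simp only [Finset.mem_filter, Set.Finite.mem_toFinset, one_mul]
      refine and_congr_right fun hS => ?_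
      rw [and_comm]
      refine and_congr_right fun _ => ⟨fun h i hi his => ?_, fun h i hi => ?_⟩
      · refine lt_of_le_of_ne (not_lt.1 fun hneg => his (h ?_)) ((hc S hS.1 hS.2).2.2 i hi).symm
        exact Finset.mem_filter.2 ⟨hi, hneg⟩
      · obtain ⟨hiS, hneg⟩ := Finset.mem_filter.1 hi
        by_contra his
        exact absurd (h i hiS his) (not_lt.2 hneg.le)
    rw [existsUnique_congr hiff]
    rcases Finset.mem_insert.1 hs with rfl | hs
    · obtain ⟨S, hS, hqS⟩ := exists_openSimplex_of_mem_space (hspace.symm ▸ hq.1 : q ∈ K.space)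
      have hcard : S.card = polyDim P + 1 := by
        refine le_antisymm (card_le_polyDim_add_one ?_ (K.indep hS)) ?_
        · rw [← hspace]; exact Geometry.SimplicialComplex.subset_space hS
        · by_contra hlt
          exact hq.2 S hS (by omega)
            (convexHull_subset_affineSpan _ (openSimplex_subset_convexHull S hqS))
      obtain ⟨h1, h2, -⟩ := hc S hS hcard
      refine ⟨S, ⟨⟨hS, hcard⟩, Finset.empty_subset S, fun i hi _ => ?_⟩, ?_⟩
      · rw [one_mul]
        exact weight_pos_of_mem_openSimplex (K.indep hS) hqS h1 h2 i hi
      · rintro S' ⟨⟨hS', hcard'⟩, -, hpos⟩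
        obtain ⟨h1', h2', -⟩ := hc S' hS' hcard'
        refine eq_of_mem_openSimplex hS' hS ⟨c S', fun i hi => ?_, h1', h2'⟩ hqS
        simpa using hpos i hi (Finset.notMem_empty i)
    · rw [Set.Finite.mem_toFinset] at hs
      obtain ⟨y, hy⟩ := openSimplex_nonempty (K.nonempty_of_mem_faces hs)
      exact existsUnique_fullSimplex hP hK hspace hq hc one_ne_zero hs hy
        (by rw [one_smul]; exact isFeasible_sub hq.1)
  · intro S hS s _ hsS
    rcases s.eq_empty_or_nonempty with rfl | hne
    · exact Finset.mem_insert_self _ _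
    · refine Finset.mem_insert_of_mem ?_
      rw [Finset.mem_filter, Set.Finite.mem_toFinset] at hS
      rw [Set.Finite.mem_toFinset]
      exact K.down_closed hS.1 hsS hne

/-- A face of a full-dimensional simplex `S` that contains all the vertices of `S` at which the
generic point has positive barycentric coordinate is interior to `P`. -/
theorem isCarrier_of_pos_subset (hP : IsPolytope P) (hspace : K.space = P)
    (hq : IsGeneric P K q) {S : Finset 𝔼} (hS : S ∈ K.faces) {b : 𝔼 → ℝ}
    (h1 : ∑ i ∈ S, b i = 1) (h2 : ∑ i ∈ S, b i • i = q) (h0 : ∀ i ∈ S, b i ≠ 0)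
    {s : Finset 𝔼} (hpos : S.filter (0 < b ·) ⊆ s) (hsS : s ⊆ S) :
    s ∈ K.faces ∧ IsCarrier P s := by
  have hsub : ∀ s ∈ K.faces, (s : Set 𝔼) ⊆ P := by
    intro s hs
    rw [← hspace]
    exact Geometry.SimplicialComplex.subset_space hs
  obtain ⟨i, hi, hi0⟩ := Finset.exists_lt_of_sum_lt
    (s := S) (f := fun _ => (0 : ℝ)) (g := b) (by simp [h1])
  have hne : s.Nonempty := ⟨i, hpos (Finset.mem_filter.2 ⟨hi, hi0⟩)⟩
  have hs := K.down_closed hS hsS hne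
  refine ⟨hs, ?_⟩
  obtain ⟨y, hy⟩ := openSimplex_nonempty hne
  rw [isCarrier_iff_isFeasible hP hspace hq (hsub s hs) hy, ← h2]
  have hev := eventually_mem_openSimplex hsS hy h1 (σ := -1) (fun i hi his => by
    have hle : ¬ 0 < b i := fun h => his (hpos (Finset.mem_filter.2 ⟨hi, h⟩))
    have := lt_of_le_of_ne (not_lt.1 hle) (h0 i hi)
    linarith)
  obtain ⟨ε, hε, hε0⟩ := (hev.and self_mem_nhdsWithin).exists
  exact ⟨ε, hε0, convexHull_min (hsub S hS) hP.convex (openSimplex_subset_convexHull S hε)⟩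

open scoped Classical in
/-- The intervals from the vertices of `S` at which the generic point has positive barycentric
coordinate to `S`, for `S` full-dimensional, partition the set of interior simplices. -/
theorem sum_interior_faces_eq (hP : IsPolytope P) (hK : K.faces.Finite) (hspace : K.space = P)
    (hq : IsGeneric P K q)
    (hc : ∀ S ∈ K.faces, S.card = polyDim P + 1 →
      ∑ i ∈ S, c S i = 1 ∧ ∑ i ∈ S, c S i • i = q ∧ ∀ i ∈ S, c S i ≠ 0) (f : ℕ → ℤ) :
    ∑ s ∈ hK.toFinset.filter (fun s : Finset 𝔼 => IsCarrier P s), f s.card =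
      ∑ S ∈ hK.toFinset.filter (fun S => S.card = polyDim P + 1),
        ∑ j ∈ Finset.range (polyDim P + 1 - (S.filter (0 < c S ·)).card + 1),
          ((polyDim P + 1 - (S.filter (0 < c S ·)).card).choose j : ℤ) *
            f ((S.filter (0 < c S ·)).card + j) := by
  have hsub : ∀ s ∈ K.faces, (s : Set 𝔼) ⊆ P := by
    intro s hs
    rw [← hspace]
    exact Geometry.SimplicialComplex.subset_space hs
  refine sum_interval_partition (A := fun S => S.filter (0 < c S ·))
    (fun S _ => S.filter_subset _) (fun S hS => (Finset.mem_filter.1 hS).2) ?_ ?_ f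
  · intro s hs
    rw [Finset.mem_filter, Set.Finite.mem_toFinset] at hs
    obtain ⟨hs, hcar⟩ := hs
    have hiff : ∀ S, (S ∈ hK.toFinset.filter (fun S => S.card = polyDim P + 1) ∧
        S.filter (0 < c S ·) ⊆ s ∧ s ⊆ S) ↔ (S ∈ K.faces ∧ S.card = polyDim P + 1) ∧
        s ⊆ S ∧ ∀ i ∈ S, i ∉ s → 0 < (-1) * c S i := by
      intro S
      simp only [Finset.mem_filter, Set.Finite.mem_toFinset, neg_one_mul, neg_pos]
      refine and_congr_right fun hS => ?_
      rw [and_comm]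
      refine and_congr_right fun _ => ⟨fun h i hi his => ?_, fun h i hi => ?_⟩
      · refine lt_of_le_of_ne (not_lt.1 fun hpos => his (h ?_)) ((hc S hS.1 hS.2).2.2 i hi)
        exact Finset.mem_filter.2 ⟨hi, hpos⟩
      · obtain ⟨hiS, hpos⟩ := Finset.mem_filter.1 hi
        by_contra his
        exact absurd (h i hiS his) (not_lt.2 hpos.le)
    rw [existsUnique_congr hiff]
    obtain ⟨y, hy⟩ := openSimplex_nonempty (K.nonempty_of_mem_faces hs)
    exact existsUnique_fullSimplex hP.convex hK hspace hq hc (by norm_num) hs hy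
      ((isCarrier_iff_isFeasible hP hspace hq (hsub s hs) hy).1 hcar)
  · intro S hS s hpos hsS
    rw [Finset.mem_filter, Set.Finite.mem_toFinset] at hS
    obtain ⟨h1, h2, h0⟩ := hc S hS.1 hS.2
    rw [Finset.mem_filter, Set.Finite.mem_toFinset]
    exact isCarrier_of_pos_subset hP hspace hq hS.1 h1 h2 h0 hpos hsS

/-- `h_k` counts the full-dimensional simplices with respect to which the generic point has `k`
negative barycentric coordinates. -/
theorem hComponent_eq_card (hP : Convex ℝ P) (hK : K.faces.Finite) (hspace : K.space = P)
    (hq : IsGeneric P K q)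
    (hc : ∀ S ∈ K.faces, S.card = polyDim P + 1 →
      ∑ i ∈ S, c S i = 1 ∧ ∑ i ∈ S, c S i • i = q ∧ ∀ i ∈ S, c S i ≠ 0)
    {k : ℕ} (hk : k ≤ polyDim P + 1) :
    hComponent (polyDim P) K k =
      (((hK.toFinset.filter (fun S => S.card = polyDim P + 1)).filter
        fun S => (S.filter (c S · < 0)).card = k).card : ℤ) := by
  set D := polyDim P + 1 with hD
  have hcount : ∀ i, (simplexCount K i : ℤ) =
      (((insert ∅ hK.toFinset).filter fun s => s.card = i).card : ℤ) := by
    intro i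
    rw [simplexCount]
    split_ifs with hi
    · subst hi
      have : (insert ∅ hK.toFinset).filter (fun s => s.card = 0) = {∅} := by
        ext s
        simp +contextual [Finset.card_eq_zero]
      rw [this]
      simp
    · rw [← Set.ncard_coe_finset]
      congr 2
      ext s
      simp only [Set.mem_ofPred_eq, Finset.coe_filter, Finset.mem_insert,
        Set.Finite.mem_toFinset]
      refine and_congr_left fun hs => ⟨Or.inr, fun h => h.resolve_left ?_⟩
      rintro rfl
      exact hi hs.symm
  have hsum : hComponent (polyDim P) K k = ∑ s ∈ insert ∅ hK.toFinset,
      (if s.card ≤ k then (-1) ^ (k - s.card) * ((D - s.card).choose (D - k) : ℤ) else 0) := by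
    rw [hComponent, ← Finset.sum_filter, ← Finset.sum_fiberwise_of_maps_to
      (t := Finset.range (k + 1)) (g := Finset.card) (fun s hs => by
        have := (Finset.mem_filter.1 hs).2
        exact Finset.mem_range.2 (by omega))]
    refine Finset.sum_congr rfl fun i hi => ?_
    have hik : i ≤ k := Nat.lt_succ_iff.1 (Finset.mem_range.1 hi)
    rw [Finset.filter_filter, hcount i]
    have : (insert ∅ hK.toFinset).filter (fun s => s.card ≤ k ∧ s.card = i) =
        (insert ∅ hK.toFinset).filter (fun s => s.card = i) :=
      Finset.filter_congr fun s _ => ⟨fun h => h.2, fun h => ⟨h ▸ hik, h⟩⟩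
    rw [this, Finset.sum_congr rfl (g := fun _ => (-1) ^ (k - i) * ((D - i).choose (D - k) : ℤ))
      fun s hs => by rw [(Finset.mem_filter.1 hs).2]]
    rw [Finset.sum_const, nsmul_eq_mul, mul_comm]
  rw [hsum, sum_faces_eq hP hK hspace hq hc
    (fun i => if i ≤ k then (-1) ^ (k - i) * ((D - i).choose (D - k) : ℤ) else 0),
    Finset.card_filter]
  push_cast
  refine Finset.sum_congr rfl fun S hS => ?_
  rw [← hD]
  refine sum_hComponent_interval ?_ hk
  rw [← (Finset.mem_filter.1 hS).2]
  exact Finset.card_le_card (S.filter_subset _)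

end Coordinates

/-- In a conical family on a polytope of positive dimension no single point is interior. -/
theorem IsConical.not_isCarrier_singleton {P : Set 𝔼} (hP : IsPolytope P) (hd : 1 ≤ polyDim P)
    {v : Set 𝔼 → 𝔼} (hv : IsApexChoice P v) {K : Finset (Finset 𝔼)} (hK : IsConical P v K)
    {w : 𝔼} (hw : {w} ∈ K) : ¬ IsCarrier P {w} := by
  intro h
  have hwP : w ∈ P := by simpa using hK.subset _ hw
  have hPP := self_mem_polyFaces ⟨w, hwP⟩
  by_cases hwv : w = v P
  · have h1 := carrierFace_of_mem_extremePoints (hv P hPP)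
    have h2 := h.2 _ (carrierFace_mem_polyFaces hP (hwv ▸ hwP : v P ∈ P)) (by simp [h1, hwv])
    rw [← h2, h1, polyDim, vectorSpan_singleton, finrank_bot] at hd
    omega
  · obtain ⟨-, G, hG, hvG, hsG⟩ := hK.erase_mem P hPP {w} hw (hK.subset _ hw) (by simpa using hwv)
    rw [Finset.erase_eq_of_notMem (by simpa using Ne.symm hwv)] at hsG
    rw [h.2 G hG hsG] at hvG
    exact hvG (hv P hPP).1

theorem simplexNumber_of_nonpos (d : ℕ) {r : ℤ} (hr : r ≤ 0) : simplexNumber d r = 0 :=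
  if_pos hr

theorem simplexNumber_shift {d n j : ℕ} (hd : 1 ≤ d) :
    simplexNumber d (((n + 2 : ℕ) : ℤ) - d - 1 + j) = ((n + j).choose d : ℤ) := by
  rw [simplexNumber]
  split_ifs with h
  · rw [Nat.choose_eq_zero_of_lt (by omega), Nat.cast_zero]
  · congr 2
    omega

theorem IsPointedTriangulation.interiorNumber_eq {P : Set 𝔼} (hP : IsPolytope P)
    {K : Geometry.SimplicialComplex ℝ 𝔼} {v : Set 𝔼 → 𝔼} (h : IsPointedTriangulation P K v)
    (hd : 1 ≤ polyDim P) (hne : P.Nonempty) (n : ℕ) :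
    interiorNumber v P n = ∑ j ∈ Finset.range (polyDim P), hComponent (polyDim P) K j *
      simplexNumber (polyDim P) ((n : ℤ) - (polyDim P : ℤ) - 1 + (j : ℤ)) := by
  classical
  match n with
  | 0 =>
    rw [interiorNumber, Finset.sum_eq_zero]
    intro j hj
    rw [Finset.mem_range] at hj
    rw [simplexNumber_of_nonpos _ (by omega), mul_zero]
  | 1 =>
    rw [interiorNumber, if_neg (by omega), Finset.sum_eq_zero]
    intro j hj
    rw [Finset.mem_range] at hj
    rw [simplexNumber_of_nonpos _ (by omega), mul_zero]
  | n + 2 =>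
    have hcon := h.isConical hP
    obtain ⟨q, hq⟩ := exists_isGeneric hP.convex hne h.finite
    obtain ⟨c, hc⟩ := hq.exists_coords h.space_eq hd
    set 𝒮 := h.finite.toFinset.filter (fun S => S.card = polyDim P + 1) with h𝒮
    have hsplit : ∀ S ∈ 𝒮, (S.filter (c S · < 0)).card + (S.filter (0 < c S ·)).card =
        polyDim P + 1 := by
      intro S hS
      rw [h𝒮, Finset.mem_filter, Set.Finite.mem_toFinset] at hS
      rw [← hS.2, ← Finset.card_filter_add_card_filter_not (s := S) (c S · < 0)]
      congr 2
      refine Finset.filter_congr fun i hi => ⟨fun h => not_lt.2 h.le, fun h' => ?_⟩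
      exact lt_of_le_of_ne (not_lt.1 h') ((hc S hS.1 hS.2).2.2 i hi).symm
    -- At least two coordinates are positive: otherwise an interval of interior simplices would
    -- start at a single vertex.
    have hpos : ∀ S ∈ 𝒮, 2 ≤ (S.filter (0 < c S ·)).card := by
      intro S hS
      rw [h𝒮, Finset.mem_filter, Set.Finite.mem_toFinset] at hS
      obtain ⟨h1, h2, h0⟩ := hc S hS.1 hS.2
      obtain ⟨hs, hcar⟩ := isCarrier_of_pos_subset hP h.space_eq hq hS.1 h1 h2 h0
        (Finset.Subset.refl _) (S.filter_subset _)
      have hcard := (K.nonempty_of_mem_faces hs).card_pos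
      by_contra hlt
      obtain ⟨w, hw⟩ := Finset.card_eq_one.1 (by omega : (S.filter (0 < c S ·)).card = 1)
      rw [hw] at hs hcar
      exact hcon.not_isCarrier_singleton hP hd h.apex_vertex
        (h.finite.mem_toFinset.2 hs) hcar
    rw [(hcon.numbers hP P (self_mem_polyFaces hne) n).2,
      sum_interior_faces_eq hP h.finite h.space_eq hq hc (fun i => (n.choose (i - 1) : ℤ))]
    have hterm : ∀ S ∈ 𝒮, ∑ j ∈ Finset.range (polyDim P + 1 - (S.filter (0 < c S ·)).card + 1),
        ((polyDim P + 1 - (S.filter (0 < c S ·)).card).choose j : ℤ) *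
          (n.choose ((S.filter (0 < c S ·)).card + j - 1) : ℤ) =
        ((n + (S.filter (c S · < 0)).card).choose (polyDim P) : ℤ) := by
      intro S hS
      have h1 := hsplit S hS
      have h2 := hpos S hS
      rw [sum_choose_interval _ _ _ (by omega)]
      congr 2 <;> omega
    rw [Finset.sum_congr rfl hterm, ← Finset.sum_fiberwise_of_maps_to
      (t := Finset.range (polyDim P)) (g := fun S => (S.filter (c S · < 0)).card) (fun S hS => by
        have h1 := hsplit S hS
        have h2 := hpos S hS
        exact Finset.mem_range.2 (by omega))]
    refine Finset.sum_congr rfl fun j hj => ?_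
    rw [Finset.mem_range] at hj
    rw [hComponent_eq_card hP.convex h.finite h.space_eq hq hc (by omega), simplexNumber_shift hd,
      Finset.sum_congr rfl (g := fun _ => ((n + j).choose (polyDim P) : ℤ))
      fun S hS => by rw [(Finset.mem_filter.1 hS).2], Finset.sum_const, nsmul_eq_mul]

end HVector

/-! ### The pulling triangulation -/

section Pulling

variable {m : ℕ}

local notation "𝔼" => EuclideanSpace ℝ (Fin m)

theorem notMem_affineSpan_face {P G : Set 𝔼} (hG : G ∈ polyFaces P) {p : 𝔼} (hp : p ∈ P)
    (hpG : p ∉ G) : p ∉ affineSpan ℝ G := by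
  obtain ⟨l, hl⟩ := hG.1 hG.2
  obtain ⟨g, hg⟩ := hG.2
  have hg' := hg
  rw [hl] at hg'
  intro h
  have hle : affineSpan ℝ G ≤ AffineSubspace.mk' g (LinearMap.ker (l : 𝔼 →ₗ[ℝ] ℝ)) := by
    refine affineSpan_le.2 fun a ha => ?_
    have ha' := ha
    rw [hl] at ha'
    have h1 := ha'.2 g hg'.1
    have h2 := hg'.2 a ha'.1
    rw [SetLike.mem_coe, AffineSubspace.mem_mk', LinearMap.mem_ker, vsub_eq_sub, map_sub]
    simp only [ContinuousLinearMap.coe_coe]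
    linarith
  have h1 := hle h
  rw [AffineSubspace.mem_mk', LinearMap.mem_ker, vsub_eq_sub, map_sub] at h1
  simp only [ContinuousLinearMap.coe_coe] at h1
  apply hpG
  rw [hl]
  exact ⟨hp, fun y hy => by linarith [hg'.2 y hy]⟩

theorem affineIndependent_insert_of_notMem {s : Finset 𝔼} {p : 𝔼}
    (hs : AffineIndependent ℝ ((↑) : s → 𝔼)) (hp : p ∉ affineSpan ℝ (s : Set 𝔼)) :
    AffineIndependent ℝ ((↑) : ↥(insert p s) → 𝔼) := by
  have hps : p ∉ s := fun h => hp (subset_affineSpan ℝ _ h)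
  refine AffineIndependent.affineIndependent_of_notMem_span
    (i := (⟨p, Finset.mem_insert_self p s⟩ : ↥(insert p s))) ?_ ?_
  · have hmem : ∀ x : {y : ↥(insert p s) // y ≠ ⟨p, Finset.mem_insert_self p s⟩},
        (x.1 : 𝔼) ∈ s := fun x => (Finset.mem_insert.1 x.1.2).resolve_left
          fun h => x.2 (Subtype.ext h)
    let e : {y : ↥(insert p s) // y ≠ ⟨p, Finset.mem_insert_self p s⟩} ↪ s :=
      ⟨fun x => ⟨x.1, hmem x⟩, fun x y hxy =>
        Subtype.ext (Subtype.ext (congrArg (fun z : s => (z : 𝔼)) hxy))⟩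
    exact hs.comp_embedding e
  · intro h
    refine hp (affineSpan_mono ℝ ?_ h)
    rintro _ ⟨x, hx, rfl⟩
    exact (Finset.mem_insert.1 x.2).resolve_left fun h => hx (Subtype.ext h)

/-- Two points of faces avoiding `p` that lie on the same ray from `p` are equal. -/
theorem eq_of_same_ray {P F G : Set 𝔼} (hF : F ∈ polyFaces P) (hG : G ∈ polyFaces P) {p : 𝔼}
    (hp : p ∈ P) (hpF : p ∉ F) (hpG : p ∉ G) {y z : 𝔼} (hy : y ∈ F) (hz : z ∈ G) {a b : ℝ}
    (ha : a < 1) (hb : b < 1) (h : a • p + (1 - a) • y = b • p + (1 - b) • z) : y = z := by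
  wlog hab : a ≤ b generalizing F G y z a b
  · exact (this hG hF hpG hpF hz hy hb ha h.symm (le_of_not_ge hab)).symm
  have ha' : 1 - a ≠ 0 := by linarith
  have hb' : 1 - b ≠ 0 := by linarith
  rcases hab.eq_or_lt with rfl | hlt
  · exact smul_right_injective _ ha' (add_left_cancel h)
  · refine absurd (hF.1.isExtreme.left_mem_of_mem_openSegment hp (polyFaces_subset hG hz) hy
      ⟨(b - a) / (1 - a), (1 - b) / (1 - a), div_pos (by linarith) (by linarith),
        div_pos (by linarith) (by linarith), by field_simp; ring, ?_⟩) hpF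
    apply smul_right_injective _ ha'
    beta_reduce
    rw [smul_add, smul_smul, smul_smul, mul_div_cancel₀ _ ha', mul_div_cancel₀ _ ha', sub_smul,
      ← sub_eq_zero]
    rw [← sub_eq_zero] at h
    rw [← neg_eq_zero, ← h]
    module

/-- The point where a ray from `p` leaves a polytope lies on faces avoiding `p`. -/
theorem exists_exit_point {F : Set 𝔼} (hF : IsPolytope F) {p x : 𝔼} (hx : x ∈ F)
    (hxp : x ≠ p) : ∃ y ∈ F, p ∉ carrierFace F y ∧ x ∈ segment ℝ p y := by
  obtain ⟨R, hR⟩ := hF.isCompact.isBounded.subset_closedBall p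
  have hnorm : 0 < ‖x - p‖ := norm_pos_iff.2 (sub_ne_zero.2 hxp)
  have hbound : ∀ t : ℝ, 0 ≤ t → p + t • (x - p) ∈ F → t ≤ R / ‖x - p‖ := by
    intro t ht hmem
    have := hR hmem
    rw [mem_closedBall_iff_norm, add_sub_cancel_left, norm_smul, Real.norm_of_nonneg ht] at this
    exact (le_div_iff₀ hnorm).2 this
  set A : Set ℝ := Set.Icc 1 (R / ‖x - p‖) ∩ {t | p + t • (x - p) ∈ F} with hA
  have hcont : Continuous fun t : ℝ => p + t • (x - p) := by fun_prop
  have hAc : IsCompact A := isCompact_Icc.inter_right (hF.isCompact.isClosed.preimage hcont)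
  have h1 : p + (1 : ℝ) • (x - p) ∈ F := by simpa using hx
  obtain ⟨T, ⟨⟨hT1, -⟩, hTF⟩, hmax⟩ :=
    hAc.exists_isGreatest ⟨1, ⟨le_refl 1, hbound 1 zero_le_one h1⟩, h1⟩
  have hT0 : 0 < T := by linarith
  refine ⟨p + T • (x - p), hTF, ?_, ?_⟩
  · rintro ⟨-, ε, hε, hmem⟩
    have he : p + T • (x - p) + ε • (p + T • (x - p) - p) = p + (T + ε * T) • (x - p) := by module
    rw [he] at hmem
    have hpos : 0 < ε * T := by positivity
    have := hmax ⟨⟨by linarith, hbound _ (by linarith) hmem⟩, hmem⟩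
    linarith
  · refine ⟨1 - T⁻¹, T⁻¹, sub_nonneg.2 (inv_le_one_of_one_le₀ hT1), by positivity, by ring, ?_⟩
    match_scalars <;> field_simp
    ring

/-- A choice of apexes is coherent if a face contained in `F` and containing the apex of `F` has the
same apex. -/
structure IsCoherentApex (P : Set 𝔼) (v : Set 𝔼 → 𝔼) : Prop where
  apex : IsApexChoice P v
  coherent : ∀ F ∈ polyFaces P, ∀ G ∈ polyFaces P, G ⊆ F → v F ∈ G → v G = v F

/-- The first vertices of the faces in an enumeration of the vertices of `P` are coherent. -/
theorem exists_isCoherentApex {P : Set 𝔼} (hP : IsPolytope P) : ∃ v, IsCoherentApex P v := by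
  obtain ⟨r, hr⟩ := Set.countable_iff_exists_injOn.1 hP.finite_extremePoints.countable
  have key : ∀ F : Set 𝔼, ∃ p, F ∈ polyFaces P →
      p ∈ F.extremePoints ℝ ∧ ∀ p' ∈ F.extremePoints ℝ, r p ≤ r p' := by
    intro F
    by_cases hF : F ∈ polyFaces P
    · have hpol := isPolytope_of_mem_polyFaces hP hF
      obtain ⟨p, hp, hmin⟩ := Set.exists_min_image _ r hpol.finite_extremePoints
        (hpol.isCompact.extremePoints_nonempty hF.2)
      exact ⟨p, fun _ => ⟨hp, hmin⟩⟩
    · exact ⟨0, fun h => absurd h hF⟩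
  choose v hv using key
  refine ⟨v, fun F hF => (hv F hF).1, fun F hF G hG hGF hvG => ?_⟩
  have hGext := (mem_polyFaces_of_subset hF hG hGF).1.isExtreme.extremePoints_subset_extremePoints
  have hFext := hF.1.isExtreme.extremePoints_subset_extremePoints
  have h1 := (hv F hF).2 _ (hGext (hv G hG).1)
  have h2 := (hv G hG).2 _
    (inter_extremePoints_subset_extremePoints_of_subset hGF ⟨hvG, (hv F hF).1⟩)
  exact hr (hFext (hGext (hv G hG).1)) (hFext (hv F hF).1) (le_antisymm h2 h1)

/-- The simplices of the pulling triangulation of `P` with top face `F`: the vertex sets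
`{v F₁, …, v Fₖ}` of chains of faces `F₁ ⊂ ⋯ ⊂ Fₖ = F` in which `Fᵢ` avoids the apex of
`Fᵢ₊₁`. -/
inductive IsPulled (P : Set 𝔼) (v : Set 𝔼 → 𝔼) : Set 𝔼 → Finset 𝔼 → Prop
  | apex {F : Set 𝔼} (hF : F ∈ polyFaces P) : IsPulled P v F {v F}
  | cone {F G : Set 𝔼} {s : Finset 𝔼} (hF : F ∈ polyFaces P) (hGF : G ⊆ F) (hv : v F ∉ G)
      (hs : IsPulled P v G s) : IsPulled P v F (insert (v F) s)

variable {P : Set (EuclideanSpace ℝ (Fin m))}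
  {v : Set (EuclideanSpace ℝ (Fin m)) → EuclideanSpace ℝ (Fin m)}

theorem IsPulled.face_mem {F : Set 𝔼} {s : Finset 𝔼} (h : IsPulled P v F s) :
    F ∈ polyFaces P := by
  cases h <;> assumption

theorem IsPulled.apex_mem {F : Set 𝔼} {s : Finset 𝔼} (h : IsPulled P v F s) : v F ∈ s := by
  cases h <;> simp

theorem IsPulled.subset (hv : IsApexChoice P v) {F : Set 𝔼} {s : Finset 𝔼}
    (h : IsPulled P v F s) : (s : Set 𝔼) ⊆ F := by
  induction h with
  | apex hF => simpa using (hv _ hF).1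
  | cone hF hGF _ _ ih =>
    rw [Finset.coe_insert]
    exact Set.insert_subset (hv _ hF).1 (ih.trans hGF)

theorem IsPulled.subset_extremePoints (hv : IsApexChoice P v) {F : Set 𝔼} {s : Finset 𝔼}
    (h : IsPulled P v F s) : (s : Set 𝔼) ⊆ P.extremePoints ℝ := by
  induction h with
  | apex hF =>
    simpa using hF.1.isExtreme.extremePoints_subset_extremePoints (hv _ hF)
  | cone hF _ _ _ ih =>
    rw [Finset.coe_insert]
    exact Set.insert_subset (hF.1.isExtreme.extremePoints_subset_extremePoints (hv _ hF)) ih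

theorem IsPulled.exists_of_subset {F : Set 𝔼} {s : Finset 𝔼} (h : IsPulled P v F s) :
    ∀ t ⊆ s, t.Nonempty → ∃ G ⊆ F, IsPulled P v G t := by
  induction h with
  | @apex F hF =>
    intro t ht hne
    rw [hne.subset_singleton_iff.1 ht]
    exact ⟨F, subset_rfl, .apex hF⟩
  | @cone F G s hF hGF hvG hs ih =>
    intro t ht hne
    by_cases hvt : v F ∈ t
    · rw [← Finset.insert_erase hvt]
      rcases (t.erase (v F)).eq_empty_or_nonempty with he | hne'
      · rw [he]
        exact ⟨F, subset_rfl, .apex hF⟩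
      · obtain ⟨H, hHG, hH⟩ := ih _ (Finset.subset_insert_iff.1 ht) hne'
        exact ⟨F, subset_rfl, .cone hF (hHG.trans hGF) (fun h => hvG (hHG h)) hH⟩
    · obtain ⟨H, hHG, hH⟩ := ih t ((Finset.subset_insert_iff_of_notMem hvt).1 ht) hne
      exact ⟨H, hHG.trans hGF, hH⟩

theorem IsPulled.affineIndependent (hv : IsApexChoice P v) {F : Set 𝔼} {s : Finset 𝔼}
    (h : IsPulled P v F s) : AffineIndependent ℝ ((↑) : s → 𝔼) := by
  induction h with
  | @apex F hF =>
    have : Subsingleton ({v F} : Finset 𝔼) := by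
      constructor
      rintro ⟨a, ha⟩ ⟨b, hb⟩
      exact Subtype.ext ((Finset.mem_singleton.1 ha).trans (Finset.mem_singleton.1 hb).symm)
    exact affineIndependent_of_subsingleton ℝ _
  | cone hF hGF hvG hs ih =>
    refine affineIndependent_insert_of_notMem ih fun h => ?_
    exact notMem_affineSpan_face hs.face_mem (polyFaces_subset hF (hv _ hF).1) hvG
      (affineSpan_mono ℝ (hs.subset hv) h)

/-- The apex of the carrier of an interior point of a pulled simplex is the apex of its top
face. -/
theorem IsPulled.apex_carrierFace (hP : IsPolytope P) (hv : IsCoherentApex P v) {F : Set 𝔼}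
    {s : Finset 𝔼} (h : IsPulled P v F s) {x : 𝔼} (hx : x ∈ openSimplex s) :
    v (carrierFace P x) = v F := by
  have hsF := h.subset hv.apex
  have hxF : x ∈ F := convexHull_min hsF (convex_of_mem_polyFaces hP h.face_mem)
    (openSimplex_subset_convexHull s hx)
  have hxP := polyFaces_subset h.face_mem hxF
  refine hv.coherent F h.face_mem _ (carrierFace_mem_polyFaces hP hxP)
    (carrierFace_subset_face h.face_mem hxF) ?_
  exact (isCarrier_carrierFace hP (hsF.trans (polyFaces_subset h.face_mem)) hx).1 h.apex_mem

/-- The open pulled simplices are disjoint. -/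
theorem IsPulled.eq (hP : IsPolytope P) (hv : IsCoherentApex P v) {F : Set 𝔼} {s : Finset 𝔼}
    (hs : IsPulled P v F s) : ∀ {G : Set 𝔼} {t : Finset 𝔼} {x : 𝔼}, IsPulled P v G t →
      x ∈ openSimplex s → x ∈ openSimplex t → s = t := by
  -- A cone does not have its apex in its interior.
  have hcone : ∀ {F G : Set 𝔼} {s : Finset 𝔼}, v F ∉ G → IsPulled P v G s →
      v F ∉ openSimplex (insert (v F) s) := by
    intro F G s hvG hs hx
    obtain ⟨a, -, ha, y, hy, he⟩ := exists_of_mem_openSimplex_insert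
      (fun h => hvG (hs.subset hv.apex h)) ⟨_, hs.apex_mem⟩ hx
    have hyG : y ∈ G := convexHull_min (hs.subset hv.apex)
      (convex_of_mem_polyFaces hP hs.face_mem) (openSimplex_subset_convexHull s hy)
    have h1 : (1 - a) • (y - v F) = 0 := by
      rw [← sub_eq_zero] at he
      rw [← neg_eq_zero, ← he]
      module
    rcases smul_eq_zero.1 h1 with h | h
    · linarith
    · exact hvG (sub_eq_zero.1 h ▸ hyG)
  induction hs with
  | @apex F hF =>
    intro G t x ht hxs hxt
    have hFG : v F = v G :=
      ((IsPulled.apex hF).apex_carrierFace hP hv hxs).symm.trans (ht.apex_carrierFace hP hv hxt)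
    rw [mem_openSimplex_singleton] at hxs
    cases ht with
    | apex hG => rw [hFG]
    | cone hG hHG hvH ht =>
      rw [hxs, hFG] at hxt
      exact absurd hxt (hcone hvH ht)
  | @cone F F' s hF hF'F hvF' hs ih =>
    intro G t x ht hxs hxt
    have hFG : v F = v G := ((IsPulled.cone hF hF'F hvF' hs).apex_carrierFace hP hv hxs).symm.trans
      (ht.apex_carrierFace hP hv hxt)
    cases ht with
    | apex hG =>
      rw [mem_openSimplex_singleton] at hxt
      rw [hxt, ← hFG] at hxs
      exact absurd hxs (hcone hvF' hs)
    | @cone _ G' t hG hG'G hvG' ht =>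
      rw [← hFG] at hvG' hxt ⊢
      obtain ⟨a, -, ha, y, hy, hxy⟩ := exists_of_mem_openSimplex_insert
        (fun h => hvF' (hs.subset hv.apex h)) ⟨_, hs.apex_mem⟩ hxs
      obtain ⟨b, -, hb, z, hz, hxz⟩ := exists_of_mem_openSimplex_insert
        (fun h => hvG' (ht.subset hv.apex h)) ⟨_, ht.apex_mem⟩ hxt
      have hyF : y ∈ F' := convexHull_min (hs.subset hv.apex)
        (convex_of_mem_polyFaces hP hs.face_mem) (openSimplex_subset_convexHull s hy)
      have hzG : z ∈ G' := convexHull_min (ht.subset hv.apex)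
        (convex_of_mem_polyFaces hP ht.face_mem) (openSimplex_subset_convexHull t hz)
      have hyz := eq_of_same_ray hs.face_mem ht.face_mem (polyFaces_subset hF (hv.apex F hF).1)
        hvF' hvG' hyF hzG ha hb (hxy.symm.trans hxz)
      rw [ih ht hy (hyz ▸ hz)]

theorem exists_isPulled (hP : IsPolytope P) (hv : IsApexChoice P v) :
    ∀ F ∈ polyFaces P, ∀ x ∈ F, ∃ G ⊆ F, ∃ s, IsPulled P v G s ∧
      x ∈ convexHull ℝ (s : Set 𝔼) := by
  intro F
  induction hd : polyDim F using Nat.strong_induction_on generalizing F with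
  | _ d ih =>
  intro hF x hx
  by_cases hxv : x = v F
  · exact ⟨F, subset_rfl, {v F}, .apex hF, by simp [hxv]⟩
  have hFpol := isPolytope_of_mem_polyFaces hP hF
  obtain ⟨y, hy, hvy, hseg⟩ := exists_exit_point hFpol hx hxv
  have hH := carrierFace_mem_polyFaces hFpol hy
  have hne : carrierFace F y ≠ F := fun h => hvy (by rw [h]; exact (hv F hF).1)
  obtain ⟨G, hGH, s, hs, hys⟩ := ih _ (hd ▸ polyDim_lt hH hne) _ rfl (polyFaces_trans hP hF hH) y
    (mem_carrierFace_self hy)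
  refine ⟨F, subset_rfl, insert (v F) s, .cone hF (hGH.trans (polyFaces_subset hH))
    (fun h => hvy (hGH h)) hs, ?_⟩
  rw [Finset.coe_insert]
  exact (convex_convexHull ℝ _).segment_subset (subset_convexHull ℝ _ (Set.mem_insert _ _))
    (convexHull_mono (Set.subset_insert _ _) hys) hseg

/-- The pulling triangulation of a polytope with respect to a coherent choice of apexes. -/
def pullingComplex (hP : IsPolytope P) (hv : IsCoherentApex P v) :
    Geometry.SimplicialComplex ℝ 𝔼 where
  faces := {s | ∃ F, IsPulled P v F s}
  isRelLowerSet_faces := by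
    rintro s ⟨F, hs⟩
    refine ⟨⟨_, hs.apex_mem⟩, fun t hts ht => ?_⟩
    obtain ⟨G, -, hG⟩ := hs.exists_of_subset t hts ht
    exact ⟨G, hG⟩
  indep := fun ⟨_, hs⟩ => hs.affineIndependent hv.apex
  inter_subset_convexHull := by
    rintro s t ⟨F, hs⟩ ⟨G, ht⟩ x ⟨hxs, hxt⟩
    obtain ⟨s', hs's, hxs'⟩ := exists_openSimplex_of_mem_convexHull hxs
    obtain ⟨t', ht't, hxt'⟩ := exists_openSimplex_of_mem_convexHull hxt
    obtain ⟨F', -, hs'⟩ := hs.exists_of_subset s' hs's (nonempty_of_mem_openSimplex hxs')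
    obtain ⟨G', -, ht'⟩ := ht.exists_of_subset t' ht't (nonempty_of_mem_openSimplex hxt')
    have heq := hs'.eq hP hv ht' hxs' hxt'
    refine convexHull_mono ?_ (openSimplex_subset_convexHull s' hxs')
    exact Set.subset_inter (Finset.coe_subset.2 hs's) (heq ▸ Finset.coe_subset.2 ht't)

theorem isPointedTriangulation_pullingComplex (hP : IsPolytope P) (hne : P.Nonempty)
    (hv : IsCoherentApex P v) : IsPointedTriangulation P (pullingComplex hP hv) v where
  finite := by
    refine (hP.finite_extremePoints.toFinset.powerset.finite_toSet).subset ?_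
    rintro s ⟨F, hs⟩
    rw [Finset.mem_coe, Finset.mem_powerset, ← Finset.coe_subset, Set.Finite.coe_toFinset]
    exact hs.subset_extremePoints hv.apex
  space_eq := by
    ext x
    rw [Geometry.SimplicialComplex.mem_space_iff]
    constructor
    · rintro ⟨s, ⟨F, hs⟩, hx⟩
      exact convexHull_min ((hs.subset hv.apex).trans (polyFaces_subset hs.face_mem)) hP.convex hx
    · intro hx
      obtain ⟨G, -, s, hs, hxs⟩ := exists_isPulled hP hv.apex P (self_mem_polyFaces hne) x hx
      exact ⟨s, ⟨G, hs⟩, hxs⟩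
  apex_vertex := hv.apex
  apex_mem := by
    rintro F hF s ⟨G, hs⟩ hsF hcard
    obtain ⟨x, hx⟩ := openSimplex_nonempty ⟨_, hs.apex_mem⟩
    have hxF := hsF (openSimplex_subset_convexHull s hx)
    have hsP := (hs.subset hv.apex).trans (polyFaces_subset hs.face_mem)
    have hcar := isCarrier_carrierFace hP hsP hx
    have hle := card_le_polyDim_add_one hcar.1 (hs.affineIndependent hv.apex)
    -- For dimension reasons the carrier of a full-dimensional simplex of `F` is `F`.
    have heq : carrierFace P x = F := face_eq_of_polyDim_le
      (mem_polyFaces_of_subset hF (carrierFace_mem_polyFaces hP (polyFaces_subset hF hxF))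
        (carrierFace_subset_face hF hxF)) (by omega)
    have hvF := hs.apex_carrierFace hP hv hx
    rw [heq] at hvF
    rw [hvF]
    exact subset_convexHull ℝ _ hs.apex_mem
  apex_eq := by
    intro F₁ h₁ F₂ h₂ hv₁ hv₂
    have hF : F₁ ∩ F₂ ∈ polyFaces P := ⟨h₁.1.inter h₂.1, _, hv₁⟩
    rw [← hv.coherent F₁ h₁ _ hF Set.inter_subset_left hv₁,
      ← hv.coherent F₂ h₂ _ hF Set.inter_subset_right hv₂]
  edge_mem := by
    intro F hF w hw hne
    have hwP : w ∈ P.extremePoints ℝ := hF.1.isExtreme.extremePoints_subset_extremePoints hw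
    have hwface : {w} ∈ polyFaces P :=
      carrierFace_of_mem_extremePoints hwP ▸ carrierFace_mem_polyFaces hP hwP.1
    have hvw : v {w} = w := (hv.apex _ hwface).1
    refine ⟨_, ⟨F, .cone hF (Set.singleton_subset_iff.2 hw.1) (fun h => hne ?_)
      (.apex hwface)⟩, ?_⟩
    · exact (Set.mem_singleton_iff.1 h).symm
    · rw [Finset.coe_insert, Finset.coe_singleton, hvw]

end Pulling

/-! ### Simplices -/

section Simplex

variable {m : ℕ}

local notation "𝔼" => EuclideanSpace ℝ (Fin m)

/-- The complex of all faces of the simplex with affinely independent vertex set `T`. -/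
def simplexComplex (T : Finset 𝔼) (hT : AffineIndependent ℝ ((↑) : T → 𝔼)) :
    Geometry.SimplicialComplex ℝ 𝔼 where
  faces := {s | s ⊆ T ∧ s.Nonempty}
  isRelLowerSet_faces := fun _ hs => ⟨hs.2, fun _ hts ht => ⟨hts.trans hs.1, ht⟩⟩
  indep hs := hT.mono (Finset.coe_subset.2 hs.1)
  inter_subset_convexHull hs ht := by
    rw [hT.convexHull_inter hs.1 ht.1]

theorem finite_simplexComplex (T : Finset 𝔼) (hT : AffineIndependent ℝ ((↑) : T → 𝔼)) :
    (simplexComplex T hT).faces.Finite :=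
  T.powerset.finite_toSet.subset fun _ hs => Finset.mem_coe.2 (Finset.mem_powerset.2 hs.1)

theorem toFinset_simplexComplex (T : Finset 𝔼) (hT : AffineIndependent ℝ ((↑) : T → 𝔼)) :
    (finite_simplexComplex T hT).toFinset = T.powerset.erase ∅ := by
  ext s
  rw [Set.Finite.mem_toFinset, Finset.mem_erase, Finset.mem_powerset, and_comm,
    ← Finset.nonempty_iff_ne_empty]
  rfl

/-- The faces of a simplex form a conical family for every choice of apexes, coherent or not: every
vertex is joined to everything. -/
theorem isConical_simplex {T : Finset 𝔼} (hT : AffineIndependent ℝ ((↑) : T → 𝔼))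
    {v : Set 𝔼 → 𝔼} (hv : IsApexChoice (convexHull ℝ (T : Set 𝔼)) v) :
    IsConical (convexHull ℝ (T : Set 𝔼)) v (T.powerset.erase ∅) := by
  rw [← toFinset_simplexComplex T hT]
  refine isConical_of_star ⟨T, rfl⟩ (finite_simplexComplex T hT)
    (fun s hs => (Finset.coe_subset.2 hs.1).trans (subset_convexHull ℝ _))
    (fun F hF => (hv F hF).1) fun F hF y hy => ?_
  have hvT : v F ∈ T :=
    extremePoints_convexHull_subset (hF.1.isExtreme.extremePoints_subset_extremePoints (hv F hF))
  exact ⟨T, ⟨subset_rfl, _, hvT⟩, hvT, polyFaces_subset hF hy⟩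

theorem sum_choose_powerset {α : Type*} [DecidableEq α] (T : Finset α) {d : ℕ}
    (hT : T.card = d + 1) (n : ℕ) :
    ∑ s ∈ T.powerset.erase ∅, (n.choose (s.card - 1) : ℤ) = ((n + d + 1).choose d : ℤ) := by
  have h1 := Finset.sum_powerset_apply_card
    (fun j => if j = 0 then (0 : ℤ) else n.choose (j - 1)) (x := T)
  rw [← Finset.add_sum_erase _ _ (Finset.empty_mem_powerset T), Finset.card_empty, if_pos rfl,
    zero_add, hT, Finset.sum_range_succ', if_pos rfl, smul_zero, add_zero] at h1
  have h2 : ∑ s ∈ T.powerset.erase ∅, (n.choose (s.card - 1) : ℤ) =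
      ∑ s ∈ T.powerset.erase ∅, if s.card = 0 then (0 : ℤ) else n.choose (s.card - 1) := by
    refine Finset.sum_congr rfl fun s hs => ?_
    rw [if_neg (Finset.card_ne_zero.2 (Finset.nonempty_iff_ne_empty.2 (Finset.mem_erase.1 hs).1))]
  rw [h2, h1, add_assoc n d 1, Nat.add_choose_eq, Finset.Nat.sum_antidiagonal_eq_sum_range_succ_mk]
  push_cast
  refine Finset.sum_congr rfl fun j hj => ?_
  have hj' := Finset.mem_range.1 hj
  rw [nsmul_eq_mul, mul_comm,
    Nat.choose_symm_of_eq_add (n := d + 1) (a := d - j) (b := j + 1) (by omega)]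

/-- The polytope numbers of a simplex are the simplex numbers, whatever the apexes. -/
theorem polytopeNumber_simplex {T : Finset 𝔼} (hT : AffineIndependent ℝ ((↑) : T → 𝔼)) {d : ℕ}
    (hcard : T.card = d + 1) {v : Set 𝔼 → 𝔼}
    (hv : IsApexChoice (convexHull ℝ (T : Set 𝔼)) v) (n : ℕ) :
    polytopeNumber v (convexHull ℝ (T : Set 𝔼)) n = simplexNumber d n := by
  classical
  match n with
  | 0 => rw [polytopeNumber, simplexNumber_of_nonpos _ (by simp)]
  | 1 =>
    rw [polytopeNumber, simplexNumber, if_neg (by norm_num)]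
    simp
  | n + 2 =>
    have hne : (convexHull ℝ (T : Set 𝔼)).Nonempty :=
      convexHull_nonempty_iff.2 (Finset.coe_nonempty.2 (Finset.card_pos.1 (by omega)))
    have hcon := isConical_simplex hT hv
    rw [(hcon.numbers ⟨T, rfl⟩ _ (self_mem_polyFaces hne) n).1,
      Finset.filter_true_of_mem hcon.subset, sum_choose_powerset T hcard, simplexNumber,
      if_neg (by omega)]
    congr 2
    omega

end Simplex

/-- Every `d`-polytope `P`, `d ≥ 1`, has a pointed triangulation, and for every pointed
triangulation `K` of `P` the interior polytope numbers of `P` are the reversed `h`-vector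
combination of the simplex numbers `α^d`; here `α^d` is the polytope number sequence of every
`d`-simplex. -/
theorem theorem2 {m : ℕ} (d : ℕ) (hd : 1 ≤ d) (P : Set (EuclideanSpace ℝ (Fin m)))
    (hP : IsPolytope P) (hdim : polyDim P = d) :
    (∃ (K : Geometry.SimplicialComplex ℝ (EuclideanSpace ℝ (Fin m)))
      (v : Set (EuclideanSpace ℝ (Fin m)) → EuclideanSpace ℝ (Fin m)),
      IsPointedTriangulation P K v) ∧
    (∀ (K : Geometry.SimplicialComplex ℝ (EuclideanSpace ℝ (Fin m)))
      (v : Set (EuclideanSpace ℝ (Fin m)) → EuclideanSpace ℝ (Fin m)),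
      IsPointedTriangulation P K v → ∀ n : ℕ,
        interiorNumber v P n =
          ∑ j ∈ Finset.range d,
            hComponent d K j * simplexNumber d ((n : ℤ) - (d : ℤ) - 1 + (j : ℤ))) ∧
    (∀ (T : Finset (EuclideanSpace ℝ (Fin m))), AffineIndependent ℝ ((↑) : T → EuclideanSpace ℝ (Fin m)) →
      T.card = d + 1 →
      ∀ v : Set (EuclideanSpace ℝ (Fin m)) → EuclideanSpace ℝ (Fin m),
        IsApexChoice (convexHull ℝ (T : Set _)) v → ∀ n : ℕ,
          polytopeNumber v (convexHull ℝ (T : Set _)) n = simplexNumber d (n : ℤ)) := by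
  subst hdim
  have hne : P.Nonempty := by
    by_contra h
    rw [Set.not_nonempty_iff_eq_empty.1 h, polyDim, vectorSpan_empty, finrank_bot] at hd
    omega
  obtain ⟨v, hv⟩ := exists_isCoherentApex hP
  exact ⟨⟨_, v, isPointedTriangulation_pullingComplex hP hne hv⟩,
    fun K v h n => h.interiorNumber_eq hP hd hne n,
    fun T hT hcard v hv n => polytopeNumber_simplex hT hcard hv n⟩
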